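/- Let $F$ be a field and let $n\ge 1$. A subset $S$ of the matrix algebra $M_n(F)$ is called an irredundant generating set if $S$ generates $M_n(F)$ as a unital $F$-algebra and no proper subset of $S$ generates $M_n(F)$ as a unital $F$-algebra. Write $e_{i,j}$ for the $n\times n$ matrix with $1$ in position $(i,j)$ and $0$ elsewhere. 1. Every irredundant generating set of $M_n(F)$ is finite and has at most $2n-1$ elements. 2. Suppose $n>1$. Put $a_i=e_{i,i}+e_{i,i+1}$ and $a'_i=e_{i+1,i}+e_{i+1,i+1}$ for $1\le i\le n-1$, and $b=e_{1,1}$. Then $\{a_1,\dots,a_{n-1},a'_1,\dots,a'_{n-1},b\}$ is an irredundant generating set of $M_n(F)$ with exactly $2n-1$ elements. Consequently, for $n>1$, the largest cardinality of an irredundant generating set of $M_n(F)$ is exactly $2n-1$. -/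

import Mathlib

/-- A subset `S` of an `F`-algebra `A` is an irredundant generating set if it generates `A` as a
unital `F`-algebra and no proper subset of `S` does. -/
def IsIrredundantGeneratingSet (F : Type*) {A : Type*} [CommSemiring F] [Semiring A] [Algebra F A]
    (S : Set A) : Prop :=
  Algebra.adjoin F S = ⊤ ∧ ∀ T : Set A, T ⊂ S → Algebra.adjoin F T ≠ ⊤

/-- With rows and columns numbered from `0`, the `n × n` matrix `e_{i,i} + e_{i,i+1}`. -/
def upperRowMatrix (F : Type*) [Field F] (n i : ℕ) : Matrix (Fin n) (Fin n) F :=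
  Matrix.of fun p q => if p.val = i ∧ (q.val = i ∨ q.val = i + 1) then 1 else 0

/-- With rows and columns numbered from `0`, the `n × n` matrix `e_{i+1,i} + e_{i+1,i+1}`. -/
def lowerRowMatrix (F : Type*) [Field F] (n i : ℕ) : Matrix (Fin n) (Fin n) F :=
  Matrix.of fun p q => if p.val = i + 1 ∧ (q.val = i ∨ q.val = i + 1) then 1 else 0

/-- The `n × n` matrix unit with its only nonzero entry, `1`, in the top left corner. -/
def cornerMatrix (F : Type*) [Field F] (n : ℕ) : Matrix (Fin n) (Fin n) F :=
  Matrix.of fun p q => if p.val = 0 ∧ q.val = 0 then 1 else 0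

/-- The set `{a_1, …, a_{n-1}, a'_1, …, a'_{n-1}, b}` where `a_i = e_{i,i} + e_{i,i+1}`,
`a'_i = e_{i+1,i} + e_{i+1,i+1}` and `b = e_{1,1}` (here with indices starting from `1`). -/
def explicitIrredundantSet (F : Type*) [Field F] (n : ℕ) : Set (Matrix (Fin n) (Fin n) F) :=
  Set.range (fun i : Fin (n - 1) => upperRowMatrix F n i.val) ∪
    Set.range (fun i : Fin (n - 1) => lowerRowMatrix F n i.val) ∪ {cornerMatrix F n}

/-! Over the algebraic closure `K` of `F`, Burnside's theorem turns generation into irreducibility: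
matrices generate as soon as they have no common stable subspace of `Kⁿ` besides `⊥` and `⊤`, and
generation over `K` descends to `F` (`adjoin_eq_top_of_toEndExtension`). The upper bound therefore
says that a finite irreducible family on `Kⁿ` contains an irreducible subfamily of at most `2n - 1`
members.

This is proved in a relative form that supports induction (`hasSmallSubsets`): if `a < b` has
`T`-length `N` and `S` makes it simple, then `2N - 1` members of `S` suffice, and `2N - 2` suffice
when an idempotent `e` from the algebra of `T` separates the simple factors. The case `T = ∅` has `N
≤ n`. The currency is length: operators that make a subinterval of `T`-length `l` simple reduce `N`
to at most `N - l + 1`.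

Without separation, a single `s` that separates or shortens reduces to a cheaper case. If no `s`
does, each `s` acts on all simple factors of `T ∪ {s}` like one element of the algebra of `T`, for
otherwise an annihilator ideal would yield a separating idempotent (`isSeparated_of_ideal`). The
differences are then dual to suitable subspaces, so at most `l` operators make some subinterval of
length `l ≥ 2` simple.

With separation, `S` is replaced by the products `s * e` and `s * (1 - e)`. Either a proper
subinterval on which `e` is neither `0` nor `1` can be made simple, and induction applies twice, or
a minimal family has at most `N - 1` members of each of the two kinds
(`card_lt_stableLength_of_source`).

For the lower bound, each matrix of the explicit set is the only one that fails to preserve a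
certain proper subspace. -/

open Module Submodule

/-! ### Stable subspaces, simple factors and length -/

section StableLattice

variable {K V : Type*} [Field K] [AddCommGroup V] [Module K V]

/-- The subspace `W` is invariant under every operator in `T`. -/
def StableUnder (T : Set (End K V)) (W : Submodule K V) : Prop :=
  ∀ f ∈ T, W ≤ W.comap f

/-- The subspaces `c < d` are `T`-stable, and no `T`-stable subspace lies strictly between them. -/
structure IsSimpleFactor (T : Set (End K V)) (c d : Submodule K V) : Prop where
  lt : c < d
  stable_left : StableUnder T c
  stable_right : StableUnder T d
  eq_or_eq : ∀ W, StableUnder T W → c ≤ W → W ≤ d → W = c ∨ W = d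

/-- `StableChain T a b k` holds if there is a chain `a = x₀ < ⋯ < xₖ = b` of `T`-stable
subspaces. -/
inductive StableChain (T : Set (End K V)) (a : Submodule K V) : Submodule K V → ℕ → Prop
  | refl : StableUnder T a → StableChain T a a 0
  | step {b c : Submodule K V} {k : ℕ} :
      StableChain T a b k → b < c → StableUnder T c → StableChain T a c (k + 1)

/-- The largest length of a chain of `T`-stable subspaces from `a` to `b`. -/
noncomputable def stableLength (T : Set (End K V)) (a b : Submodule K V) : ℕ :=
  sSup {k | StableChain T a b k}

variable {T T' : Set (End K V)} {a b c d W W' : Submodule K V} {k l : ℕ}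

namespace StableUnder

lemma anti (hT : T ⊆ T') (h : StableUnder T' W) : StableUnder T W :=
  fun f hf => h f (hT hf)

lemma sup (h : StableUnder T W) (h' : StableUnder T W') : StableUnder T (W ⊔ W') :=
  fun f hf => sup_le ((h f hf).trans (comap_mono le_sup_left))
    ((h' f hf).trans (comap_mono le_sup_right))

lemma inf (h : StableUnder T W) (h' : StableUnder T W') : StableUnder T (W ⊓ W') :=
  fun f hf _ hv => ⟨h f hf hv.1, h' f hf hv.2⟩

lemma sSup {s : Set (Submodule K V)} (h : ∀ W ∈ s, StableUnder T W) : StableUnder T (sSup s) :=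
  fun f hf => sSup_le fun W hW => (h W hW f hf).trans (comap_mono (le_sSup hW))

lemma union (h : StableUnder T W) (h' : StableUnder T' W) : StableUnder (T ∪ T') W := by
  rintro f (hf | hf)
  exacts [h f hf, h' f hf]

lemma insert {f : End K V} (h : StableUnder T W) (hf : W ≤ W.comap f) :
    StableUnder (insert f T) W := by
  rintro g (rfl | hg)
  exacts [hf, h g hg]

lemma of_mem_adjoin (h : StableUnder T W) {x : End K V} (hx : x ∈ Algebra.adjoin K T) :
    W ≤ W.comap x := by
  induction hx using Algebra.adjoin_induction with
  | mem x hx => exact h x hx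
  | algebraMap r => exact fun v hv => by simpa [Module.algebraMap_end_apply] using W.smul_mem r hv
  | add x y _ _ hx hy => exact fun v hv => W.add_mem (hx hv) (hy hv)
  | mul x y _ _ hx hy => exact fun v hv => hx (hy hv)

end StableUnder

namespace StableChain

lemma stable_right (h : StableChain T a b k) : StableUnder T b := by
  cases h with
  | refl h => exact h
  | step _ _ h => exact h

lemma le (h : StableChain T a b k) : a ≤ b := by
  induction h with
  | refl h => exact le_rfl
  | step _ h _ ih => exact ih.trans h.le

lemma trans (h : StableChain T a b k) (h' : StableChain T b c l) : StableChain T a c (k + l) := by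
  induction h' with
  | refl _ => exact h
  | step _ h1 h2 ih => exact ih.step h1 h2

lemma anti (hT : T ⊆ T') (h : StableChain T' a b k) : StableChain T a b k := by
  induction h with
  | refl h => exact .refl (h.anti hT)
  | step _ h1 h2 ih => exact ih.step h1 (h2.anti hT)

variable [FiniteDimensional K V]

lemma add_finrank_le (h : StableChain T a b k) : k + finrank K a ≤ finrank K b := by
  induction h with
  | refl h => simp
  | step _ h _ ih => have := Submodule.finrank_lt_finrank_of_lt h; omega

lemma bddAbove : BddAbove {k | StableChain T a b k} :=
  ⟨finrank K b, fun k hk => by have := add_finrank_le hk; omega⟩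

lemma le_stableLength (h : StableChain T a b k) : k ≤ stableLength T a b :=
  le_csSup bddAbove h

end StableChain

section

variable [FiniteDimensional K V]

lemma exists_stableChain (ha : StableUnder T a) (hb : StableUnder T b) (hab : a ≤ b) :
    StableChain T a b (stableLength T a b) := by
  refine Nat.sSup_mem (s := {k | StableChain T a b k}) ?_ StableChain.bddAbove
  rcases hab.eq_or_lt with rfl | h
  · exact ⟨0, .refl ha⟩
  · exact ⟨1, (StableChain.refl ha).step h hb⟩

lemma stableLength_le_finrank (ha : StableUnder T a) (hb : StableUnder T b) (hab : a ≤ b) :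
    stableLength T a b ≤ finrank K b := by
  have := (exists_stableChain ha hb hab).add_finrank_le
  omega

lemma stableLength_self (ha : StableUnder T a) : stableLength T a a = 0 := by
  have := (exists_stableChain ha ha le_rfl).add_finrank_le
  omega

lemma stableLength_add_le (ha : StableUnder T a) (hb : StableUnder T b) (hc : StableUnder T c)
    (hab : a ≤ b) (hbc : b ≤ c) :
    stableLength T a b + stableLength T b c ≤ stableLength T a c :=
  ((exists_stableChain ha hb hab).trans (exists_stableChain hb hc hbc)).le_stableLength

lemma one_le_stableLength (ha : StableUnder T a) (hb : StableUnder T b) (hab : a < b) :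
    1 ≤ stableLength T a b :=
  ((StableChain.refl ha).step hab hb).le_stableLength

lemma stableLength_lt_of_lt_right (ha : StableUnder T a) (hb : StableUnder T b)
    (hc : StableUnder T c) (hab : a ≤ b) (hbc : b < c) :
    stableLength T a b < stableLength T a c := by
  have := stableLength_add_le ha hb hc hab hbc.le
  have := one_le_stableLength hb hc hbc
  omega

lemma stableLength_anti (hT : T ⊆ T') (ha : StableUnder T' a) (hb : StableUnder T' b)
    (hab : a ≤ b) : stableLength T' a b ≤ stableLength T a b :=
  ((exists_stableChain ha hb hab).anti hT).le_stableLength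

lemma stableLength_mono_interval (ha : StableUnder T a) (hb : StableUnder T b)
    (hc : StableUnder T c) (hd : StableUnder T d) (hac : a ≤ c) (hcd : c ≤ d) (hdb : d ≤ b) :
    stableLength T a c + stableLength T c d + stableLength T d b ≤ stableLength T a b := by
  have h1 := stableLength_add_le ha hc hd hac hcd
  have h2 := stableLength_add_le ha hd hb (hac.trans hcd) hdb
  omega

lemma stableLength_lt_of_ne (ha : StableUnder T a) (hb : StableUnder T b)
    (hc : StableUnder T c) (hd : StableUnder T d) (hac : a ≤ c) (hcd : c ≤ d) (hdb : d ≤ b)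
    (hne : ¬(c = a ∧ d = b)) : stableLength T c d < stableLength T a b := by
  have h := stableLength_mono_interval ha hb hc hd hac hcd hdb
  rcases hac.eq_or_lt with rfl | h1
  · rcases hdb.eq_or_lt with rfl | h2
    · exact absurd ⟨rfl, rfl⟩ hne
    · have := one_le_stableLength hd hb h2
      omega
  · have := one_le_stableLength ha hc h1
    omega

/-- Along a chain, pass from `x` to the pair `x ⊓ b`, `x ⊔ b`. By modularity each strict step of the
chain is strict in at least one coordinate, so the two coordinate lengths pay for the whole chain.
With the reverse inequality this makes length additive. -/
lemma stableLength_le_add (ha : StableUnder T a) (hb : StableUnder T b) (hc : StableUnder T c)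
    (hab : a ≤ b) (hbc : b ≤ c) :
    stableLength T a c ≤ stableLength T a b + stableLength T b c := by
  have key : ∀ x k, StableChain T a x k → x ≤ c →
      k ≤ stableLength T a (x ⊓ b) + stableLength T b (x ⊔ b) := by
    intro x k h
    induction h with
    | refl _ => intro _; exact Nat.zero_le _
    | @step y z k h hyz hz ih =>
      intro hzc
      have hy := h.stable_right
      have h1 := ih (hyz.le.trans hzc)
      have hay := h.le
      have hinf : a ≤ y ⊓ b := le_inf hay hab
      rcases (inf_le_inf_right b hyz.le).eq_or_lt with e1 | l1
      · rcases (sup_le_sup_right hyz.le b).eq_or_lt with e2 | l2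
        · exact absurd (eq_of_le_of_inf_le_of_sup_le hyz.le e1.ge e2.ge) hyz.ne
        · have := stableLength_lt_of_lt_right hb (hy.sup hb) (hz.sup hb) le_sup_right l2
          rw [← e1]
          omega
      · have h2 := stableLength_lt_of_lt_right ha (hy.inf hb) (hz.inf hb) hinf l1
        have h3 := stableLength_add_le hb (hy.sup hb) (hz.sup hb) le_sup_right
          (sup_le_sup_right hyz.le b)
        omega
  simpa [hbc] using key c _ (exists_stableChain ha hc (hab.trans hbc)) le_rfl

end

namespace IsSimpleFactor

lemma of_stable (hT : T ⊆ T') (h : IsSimpleFactor T c d) (hc : StableUnder T' c)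
    (hd : StableUnder T' d) : IsSimpleFactor T' c d :=
  ⟨h.lt, hc, hd, fun W hW => h.eq_or_eq W (hW.anti hT)⟩

lemma eq_of_lt (h : IsSimpleFactor T c d) (hW : StableUnder T W) (h1 : c < W) (h2 : W ≤ d) :
    W = d :=
  (h.eq_or_eq W hW h1.le h2).resolve_left h1.ne'

lemma congr (hTT' : ∀ W, StableUnder T W ↔ StableUnder T' W) :
    IsSimpleFactor T c d ↔ IsSimpleFactor T' c d :=
  ⟨fun h => ⟨h.1, (hTT' _).1 h.2, (hTT' _).1 h.3, fun W hW => h.4 W ((hTT' _).2 hW)⟩,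
    fun h => ⟨h.1, (hTT' _).2 h.2, (hTT' _).2 h.3, fun W hW => h.4 W ((hTT' _).1 hW)⟩⟩

/-- A simple factor of `T` meeting `w` nontrivially gives a simple factor below `w`. -/
lemma inf_of_not_le (h : IsSimpleFactor T c d) (hW : StableUnder T W) (hn : ¬ d ⊓ W ≤ c) :
    IsSimpleFactor T (c ⊓ W) (d ⊓ W) where
  lt := (inf_le_inf_right W h.lt.le).lt_of_not_ge fun hle => hn (hle.trans inf_le_left)
  stable_left := h.stable_left.inf hW
  stable_right := h.stable_right.inf hW
  eq_or_eq X hX h1 h2 := by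
    rcases h.eq_or_eq (c ⊔ X) (h.stable_left.sup hX) le_sup_left
      (sup_le h.lt.le (h2.trans inf_le_left)) with e | e
    · left
      exact le_antisymm (le_inf (e ▸ le_sup_right) (h2.trans inf_le_right)) h1
    · right
      refine le_antisymm h2 ?_
      rw [← e, sup_comm, sup_inf_assoc_of_le _ (h2.trans inf_le_right)]
      exact sup_le le_rfl h1

variable [FiniteDimensional K V]

lemma stableLength_eq_one (h : IsSimpleFactor T c d) : stableLength T c d = 1 := by
  refine le_antisymm ?_ (one_le_stableLength h.stable_left h.stable_right h.lt)
  have hch := exists_stableChain h.stable_left h.stable_right h.lt.le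
  generalize stableLength T c d = k at hch
  rcases hch with _ | ⟨h1, h2, h3⟩
  · omega
  · rcases h1 with _ | ⟨h4, h5, h6⟩
    · omega
    · rcases h.eq_or_eq _ h6 (h4.le.trans h5.le) h2.le with e | e
      · exact absurd (h4.le.trans_lt h5) (by simp [e])
      · exact absurd h2 (by simp [e])

lemma of_stableLength_le_one (hc : StableUnder T c) (hd : StableUnder T d) (hcd : c < d)
    (h : stableLength T c d ≤ 1) : IsSimpleFactor T c d where
  lt := hcd
  stable_left := hc
  stable_right := hd
  eq_or_eq W hW h1 h2 := by
    by_contra! hne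
    have h3 := stableLength_lt_of_lt_right hc hW hd h1 (h2.lt_of_ne hne.2)
    have h4 := one_le_stableLength hc hW (h1.lt_of_ne hne.1.symm)
    omega

lemma exists_left (ha : StableUnder T a) (hb : StableUnder T b) (hab : a < b) :
    ∃ d ≤ b, IsSimpleFactor T a d := by
  obtain ⟨d, hd, hmin⟩ := WellFounded.has_min (wellFounded_lt (α := Submodule K V))
    {d | a < d ∧ d ≤ b ∧ StableUnder T d} ⟨b, hab, le_rfl, hb⟩
  refine ⟨d, hd.2.1, hd.1, ha, hd.2.2, fun W hW h1 h2 => ?_⟩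
  by_contra! hne
  exact hmin W ⟨h1.lt_of_ne hne.1.symm, h2.trans hd.2.1, hW⟩ (h2.lt_of_ne hne.2)

/-- Every proper interval of stable subspaces ends in a simple factor. -/
lemma exists_right (ha : StableUnder T a) (hb : StableUnder T b) (hab : a < b) :
    ∃ c, a ≤ c ∧ IsSimpleFactor T c b := by
  obtain ⟨c, hc, hmin⟩ := WellFounded.has_min (wellFounded_gt (α := Submodule K V))
    {c | a ≤ c ∧ c < b ∧ StableUnder T c} ⟨a, le_rfl, hab, ha⟩
  refine ⟨c, hc.1, hc.2.1, hc.2.2, hb, fun W hW h1 h2 => ?_⟩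
  by_contra! hne
  exact hmin W ⟨hc.1.trans h1, h2.lt_of_ne hne.2, hW⟩ (h1.lt_of_ne hne.1.symm)

/-- The piece from `c` to `d` counts for `1` under `T'` instead of its `T`-length, and the pieces on
either side can only get shorter. This is the accounting step of every induction below. -/
lemma stableLength_add_le_of_subset (hT : T ⊆ T') (h : IsSimpleFactor T' c d)
    (ha : StableUnder T' a) (hb : StableUnder T' b) (hac : a ≤ c) (hdb : d ≤ b) :
    stableLength T' a b + stableLength T c d ≤ stableLength T a b + 1 := by
  have h1 := stableLength_le_add ha h.stable_left hb hac (h.lt.le.trans hdb)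
  have h2 := stableLength_le_add h.stable_left h.stable_right hb h.lt.le hdb
  have h3 := h.stableLength_eq_one
  have h4 := stableLength_anti hT ha h.stable_left hac
  have h5 := stableLength_anti hT h.stable_right hb hdb
  have h6 := stableLength_mono_interval (ha.anti hT) (hb.anti hT) (h.stable_left.anti hT)
    (h.stable_right.anti hT) hac h.lt.le hdb
  omega

end IsSimpleFactor

/-- If every simple factor for `T'` has length at least two for `T ⊆ T'`, lengths at least double
when passing from `T'` to `T`. -/
lemma two_mul_stableLength_le [FiniteDimensional K V] (hT : T ⊆ T') (ha : StableUnder T' a)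
    (h : ∀ c d, a ≤ c → d ≤ b → IsSimpleFactor T' c d → 2 ≤ stableLength T c d)
    (hb : StableUnder T' b) (hab : a ≤ b) :
    2 * stableLength T' a b ≤ stableLength T a b := by
  induction b using WellFoundedLT.induction with
  | ind b ih =>
    rcases hab.eq_or_lt with rfl | hlt
    · simp [stableLength_self ha]
    obtain ⟨c, hac, hc⟩ := IsSimpleFactor.exists_right ha hb hlt
    have h1 := ih c hc.lt (fun c' d' h1 h2 => h c' d' h1 (h2.trans hc.lt.le)) hc.stable_left hac
    have h2 := h c b hac le_rfl hc
    have h3 := stableLength_le_add ha hc.stable_left hb hac hc.lt.le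
    have h4 := hc.stableLength_eq_one
    have h5 := stableLength_add_le (ha.anti hT) (hc.stable_left.anti hT) (hb.anti hT) hac hc.lt.le
    omega

end StableLattice

/-! ### Burnside's theorem and the action on simple factors -/

section Density

variable {K : Type*} [Field K]

/-- **Burnside's theorem**: over an algebraically closed field, an irreducible algebra of operators
on a finite-dimensional space contains every operator. -/
theorem Subalgebra.eq_top_of_irreducible [IsAlgClosed K] {U : Type*} [AddCommGroup U] [Module K U]
    [FiniteDimensional K U] [Nontrivial U] (B : Subalgebra K (End K U))
    (h : ∀ W : Submodule K U, (∀ f ∈ B, W ≤ W.comap f) → W = ⊥ ∨ W = ⊤) : B = ⊤ := by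
  have simple : IsSimpleModule B U := by
    refine @IsSimpleModule.mk _ _ _ _ _ ⟨fun W => ?_⟩
    rcases h (W.restrictScalars K) (fun f hf v hv => W.smul_mem ⟨f, hf⟩ hv) with e | e
    · left
      exact (Submodule.restrictScalars_eq_bot_iff K B U).1 e
    · right
      exact (Submodule.restrictScalars_eq_top_iff K B U).1 e
  -- By Schur's lemma the `B`-endomorphisms of `U` are scalars, so every `K`-linear `g` commutes
  -- with them and Jacobson density applies to it on a finite spanning set.
  have schur := IsSimpleModule.algebraMap_end_bijective_of_isAlgClosed (A := B) (V := U) K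
  rw [eq_top_iff]
  intro g _
  let g' : End (End B U) U :=
    { toFun := g
      map_add' := g.map_add
      map_smul' := fun c v => by
        obtain ⟨r, rfl⟩ := schur.2 c
        exact g.map_smul r v }
  obtain ⟨s, hs⟩ := Module.Finite.fg_top (R := K) (M := U)
  obtain ⟨⟨f, hf⟩, hr⟩ := jacobson_density (R := B) g' s
  have : g = f := LinearMap.ext_on hs fun m hm => hr m hm
  exact this ▸ hf

/-- A family of operators closed under addition and under multiplication by arbitrary operators on
both sides contains the identity unless it is zero. -/
lemma one_mem_of_ideal {U : Type*} [AddCommGroup U] [Module K U] [FiniteDimensional K U]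
    (J : AddSubmonoid (End K U)) (hl : ∀ g, ∀ y ∈ J, g * y ∈ J) (hr : ∀ g, ∀ y ∈ J, y * g ∈ J)
    {y : End K U} (hy : y ∈ J) (hy0 : y ≠ 0) : (1 : End K U) ∈ J := by
  obtain ⟨v, hv⟩ : ∃ v, y v ≠ 0 := by
    by_contra! hn
    exact hy0 (LinearMap.ext hn)
  obtain ⟨ψ, hψ⟩ := Module.Projective.exists_dual_ne_zero K hv
  let b := Module.finBasis K U
  -- Rank-one operators around `y` send `u` to its `i`-th coordinate times `b i`; summing over the
  -- basis gives the identity.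
  have : (1 : End K U) = ∑ i, (ψ.smulRight ((ψ (y v))⁻¹ • b i)) * (y * ((b.coord i).smulRight v)) := by
    ext u
    simp only [LinearMap.sum_apply, End.mul_apply, LinearMap.smulRight_apply, map_smul, smul_smul]
    simp [hψ]
  rw [this]
  exact J.sum_mem fun i _ => hl _ _ (hr _ _ hy)

variable {V : Type*} [AddCommGroup V] [Module K V] {T : Set (End K V)} {a b c d : Submodule K V}

namespace IsSimpleFactor

/-- The vector `v` generates a simple factor as soon as it is nonzero in it. -/
lemma exists_apply_sub_mem (h : IsSimpleFactor T c d) {v w : V} (hv : v ∈ d) (hvc : v ∉ c)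
    (hw : w ∈ d) : ∃ x ∈ Algebra.adjoin K T, x v - w ∈ c := by
  -- The orbit of `v` under the algebra; together with `c` it fills `d` by simplicity.
  let O : Submodule K V := (Subalgebra.toSubmodule (Algebra.adjoin K T)).map (LinearMap.applyₗ v)
  have hO : StableUnder T O := by
    rintro f hf _ ⟨x, hx, rfl⟩
    exact ⟨f * x, (Algebra.adjoin K T).mul_mem (Algebra.subset_adjoin hf) hx, rfl⟩
  have hvO : v ∈ O := ⟨1, one_mem (Algebra.adjoin K T), rfl⟩
  have hOd : O ≤ d := by
    rintro _ ⟨x, hx, rfl⟩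
    exact h.stable_right.of_mem_adjoin hx hv
  have := h.eq_of_lt (h.stable_left.sup hO)
    (lt_of_le_of_ne le_sup_left fun e => hvc (e ▸ mem_sup_right hvO)) (sup_le h.lt.le hOd)
  rw [← this] at hw
  obtain ⟨u, hu, _, ⟨x, hx, rfl⟩, rfl⟩ := mem_sup.1 hw
  refine ⟨x, hx, ?_⟩
  simpa using c.neg_mem hu

variable [IsAlgClosed K] [FiniteDimensional K V]

/-- Every operator on a simple factor is induced by an element of the algebra generated by `T`. -/
lemma exists_lift (h : IsSimpleFactor T c d) (g : End K (d ⧸ c.submoduleOf d)) :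
    ∃ x ∈ Algebra.adjoin K T, ∀ v w : d, (w : V) = x v →
      g (Submodule.Quotient.mk v) = Submodule.Quotient.mk w := by
  let B : Subalgebra K (End K (d ⧸ c.submoduleOf d)) :=
    { carrier := {g | ∃ x ∈ Algebra.adjoin K T, ∀ v w : d, (w : V) = x v →
        g (Submodule.Quotient.mk v) = Submodule.Quotient.mk w}
      mul_mem' := by
        rintro g g' ⟨x, hx, hg⟩ ⟨x', hx', hg'⟩
        refine ⟨x * x', mul_mem hx hx', fun v w hw => ?_⟩
        rw [End.mul_apply,
          hg' v ⟨x' v, h.stable_right.of_mem_adjoin hx' v.2⟩ rfl, hg _ w hw]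
      add_mem' := by
        rintro g g' ⟨x, hx, hg⟩ ⟨x', hx', hg'⟩
        refine ⟨x + x', add_mem hx hx', fun v w hw => ?_⟩
        rw [LinearMap.add_apply, hg v ⟨x v, h.stable_right.of_mem_adjoin hx v.2⟩ rfl,
          hg' v ⟨x' v, h.stable_right.of_mem_adjoin hx' v.2⟩ rfl, ← Submodule.Quotient.mk_add]
        congr 1
        exact Subtype.ext hw.symm
      algebraMap_mem' := fun r => by
        refine ⟨algebraMap K _ r, Subalgebra.algebraMap_mem _ r, fun v w hw => ?_⟩
        rw [Module.algebraMap_end_apply] at hw ⊢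
        rw [← Submodule.Quotient.mk_smul]
        congr 1
        exact Subtype.ext hw.symm }
  have : Nontrivial (d ⧸ c.submoduleOf d) := by
    rw [Submodule.Quotient.nontrivial_iff, Ne, Submodule.submoduleOf_eq_top]
    exact h.lt.not_ge
  suffices B = ⊤ from (this ▸ Algebra.mem_top : g ∈ B)
  refine B.eq_top_of_irreducible fun W hW => ?_
  let W' : Submodule K V := (W.comap (mkQ _)).map d.subtype
  have hW' : StableUnder T W' := by
    rintro f hf _ ⟨v, hv, rfl⟩
    have hfd : ∀ v ∈ d, f v ∈ d := fun v hv => h.stable_right f hf hv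
    have hfc : c.submoduleOf d ≤ (c.submoduleOf d).comap (f.restrict hfd) :=
      fun u hu => h.stable_left f hf hu
    have hmem : (c.submoduleOf d).mapQ _ (f.restrict hfd) hfc ∈ B :=
      ⟨f, Algebra.subset_adjoin hf, fun v w hw => by
        rw [mapQ_apply]
        congr 1
        exact Subtype.ext hw.symm⟩
    exact ⟨f.restrict hfd v, hW _ hmem hv, rfl⟩
  have hcW : c ≤ W' := fun u hu => ⟨⟨u, h.lt.le hu⟩, by
    have : mkQ (c.submoduleOf d) ⟨u, h.lt.le hu⟩ = 0 := (Submodule.Quotient.mk_eq_zero _).2 hu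
    change mkQ (c.submoduleOf d) ⟨u, h.lt.le hu⟩ ∈ W
    rw [this]
    exact W.zero_mem, rfl⟩
  have hWd : W' ≤ d := map_subtype_le _ _
  rcases h.eq_or_eq W' hW' hcW hWd with e | e
  · left
    rw [eq_bot_iff]
    intro q hq
    obtain ⟨v, rfl⟩ := mkQ_surjective _ q
    have : (v : V) ∈ W' := ⟨v, hq, rfl⟩
    have hv : (v : V) ∈ c := e ▸ this
    exact (Submodule.Quotient.mk_eq_zero _).2 hv
  · right
    rw [eq_top_iff]
    intro q _
    obtain ⟨v, rfl⟩ := mkQ_surjective _ q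
    have : (v : V) ∈ W' := by
      rw [e]
      exact v.2
    obtain ⟨v', hv', e'⟩ := this
    rwa [← Subtype.ext e']

/-- An operator preserving a simple factor acts on it like some element of the algebra generated
by `T`. -/
lemma exists_sub_le (h : IsSimpleFactor T c d) {g : End K V} (hc : c ≤ c.comap g)
    (hd : d ≤ d.comap g) : ∃ x ∈ Algebra.adjoin K T, d ≤ c.comap (g - x) := by
  have hgd : ∀ v ∈ d, g v ∈ d := fun v hv => hd hv
  have hgc : c.submoduleOf d ≤ (c.submoduleOf d).comap (g.restrict hgd) := fun u hu => hc hu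
  obtain ⟨x, hx, hgx⟩ := h.exists_lift ((c.submoduleOf d).mapQ _ (g.restrict hgd) hgc)
  refine ⟨x, hx, fun v hv => ?_⟩
  have := hgx ⟨v, hv⟩ ⟨x v, h.stable_right.of_mem_adjoin hx hv⟩ rfl
  rw [mapQ_apply, Submodule.Quotient.eq] at this
  exact this

/-- A two-sided ideal of the algebra generated by `T` which does not annihilate a simple factor
contains an element acting on it as the identity. -/
lemma exists_one_sub_le (h : IsSimpleFactor T c d) (I : AddSubmonoid (End K V))
    (hI : ∀ x ∈ I, x ∈ Algebra.adjoin K T)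
    (hl : ∀ g ∈ Algebra.adjoin K T, ∀ y ∈ I, g * y ∈ I)
    (hr : ∀ g ∈ Algebra.adjoin K T, ∀ y ∈ I, y * g ∈ I)
    {y : End K V} (hy : y ∈ I) (hyd : ¬ d ≤ c.comap y) : ∃ x ∈ I, d ≤ c.comap (1 - x) := by
  have hst : ∀ x ∈ I, ∀ v : d, x v ∈ d := fun x hx v => h.stable_right.of_mem_adjoin (hI x hx) v.2
  have hst' : ∀ x ∈ Algebra.adjoin K T, ∀ v : d, x v ∈ d :=
    fun x hx v => h.stable_right.of_mem_adjoin hx v.2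
  let J : AddSubmonoid (End K (d ⧸ c.submoduleOf d)) :=
    { carrier := {g | ∃ x ∈ I, ∀ v w : d, (w : V) = x v →
        g (Submodule.Quotient.mk v) = Submodule.Quotient.mk w}
      add_mem' := by
        rintro g g' ⟨x, hx, hg⟩ ⟨x', hx', hg'⟩
        refine ⟨x + x', add_mem hx hx', fun v w hw => ?_⟩
        rw [LinearMap.add_apply, hg v ⟨x v, hst x hx v⟩ rfl, hg' v ⟨x' v, hst x' hx' v⟩ rfl,
          ← Submodule.Quotient.mk_add]
        congr 1
        exact Subtype.ext hw.symm
      zero_mem' := ⟨0, zero_mem I, fun v w hw => by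
        have : w = 0 := Subtype.ext hw
        simp [this]⟩ }
  have hJl : ∀ g, ∀ y ∈ J, g * y ∈ J := by
    rintro g y ⟨x, hx, hy⟩
    obtain ⟨x', hx', hg⟩ := h.exists_lift g
    refine ⟨x' * x, hl _ hx' _ hx, fun v w hw => ?_⟩
    rw [End.mul_apply, hy v ⟨x v, hst x hx v⟩ rfl, hg _ w hw]
  have hJr : ∀ g, ∀ y ∈ J, y * g ∈ J := by
    rintro g y ⟨x, hx, hy⟩
    obtain ⟨x', hx', hg⟩ := h.exists_lift g
    refine ⟨x * x', hr _ hx' _ hx, fun v w hw => ?_⟩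
    rw [End.mul_apply, hg v ⟨x' v, hst' x' hx' v⟩ rfl, hy _ w hw]
  have hyd' : ∀ v ∈ d, y v ∈ d := fun v hv => hst y hy ⟨v, hv⟩
  have hyc : c.submoduleOf d ≤ (c.submoduleOf d).comap (y.restrict hyd') :=
    fun u hu => h.stable_left.of_mem_adjoin (hI y hy) hu
  have hyJ : (c.submoduleOf d).mapQ _ (y.restrict hyd') hyc ∈ J :=
    ⟨y, hy, fun v w hw => by
      rw [mapQ_apply]
      congr 1
      exact Subtype.ext hw.symm⟩
  obtain ⟨x, hx, h1⟩ := one_mem_of_ideal J hJl hJr hyJ (by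
    intro e
    refine hyd fun v hv => ?_
    have := LinearMap.congr_fun e (mkQ (c.submoduleOf d) ⟨v, hv⟩)
    exact (Submodule.Quotient.mk_eq_zero (c.submoduleOf d)).1 this)
  refine ⟨x, hx, fun v hv => ?_⟩
  have := h1 ⟨v, hv⟩ ⟨x v, hst x hx ⟨v, hv⟩⟩ rfl
  rw [End.one_apply, Submodule.Quotient.eq] at this
  exact this

end IsSimpleFactor

end Density

/-! ### Idempotents separating simple factors -/

section Separation

variable {K V : Type*} [Field K] [AddCommGroup V] [Module K V] {T T' : Set (End K V)}
  {a b c d : Submodule K V}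

/-- Some idempotent in the algebra generated by `T` acts as `0` or as `1` on every simple factor
between `a` and `b`, and both cases occur. -/
def IsSeparated (T : Set (End K V)) (a b : Submodule K V) : Prop :=
  ∃ e ∈ Algebra.adjoin K T, e * e = e ∧ ¬ b ≤ a.comap e ∧ ¬ b ≤ a.comap (1 - e) ∧
    ∀ c d, a ≤ c → d ≤ b → IsSimpleFactor T c d → d ≤ c.comap e ∨ d ≤ c.comap (1 - e)

open Polynomial in
/-- Some polynomial in `x` is idempotent and has the same restriction as `x` to the subquotients on
which `x` is `0` or `1`. -/
lemma exists_idempotent_aeval [FiniteDimensional K V] (x : End K V) :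
    ∃ p q : K[X], aeval x p * x * (aeval x p * x) = aeval x p * x ∧
      1 - aeval x p * x = aeval x q * (1 - x) := by
  have hm : minpoly K x ≠ 0 := minpoly.ne_zero (Algebra.IsIntegral.isIntegral x)
  -- The extra factor `X * (1 - X)` ensures that `X` occurs to positive order and that `1 - X`
  -- divides the cofactor `g`. In a Bézout relation `u * X ^ (k + 1) + v * g = 1`, the first summand
  -- is the idempotent at `x`, and the second is its complement, divisible by `1 - X`.
  have hM : X * (1 - X) * minpoly K x ≠ 0 :=
    mul_ne_zero (mul_ne_zero X_ne_zero fun h => by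
      have := congrArg (Polynomial.eval 0) h
      simp at this) hm
  obtain ⟨g, hg, hdvd⟩ := exists_eq_pow_rootMultiplicity_mul_and_not_dvd _ hM 0
  rw [C_0, sub_zero] at hg hdvd
  generalize hk : rootMultiplicity 0 (X * (1 - X) * minpoly K x) = k at hg
  rcases k with _ | k
  · rw [pow_zero, one_mul] at hg
    exact absurd ⟨(1 - X) * minpoly K x, by rw [← hg, mul_assoc]⟩ hdvd
  have hcop : IsCoprime (X : K[X]) g :=
    (Irreducible.coprime_iff_not_dvd irreducible_X).2 hdvd
  obtain ⟨u, v, huv⟩ := hcop.pow_left (m := k + 1)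
  obtain ⟨q, hq⟩ : (1 - X : K[X]) ∣ g := by
    have h1 : IsCoprime (1 - X : K[X]) (X ^ (k + 1)) :=
      IsCoprime.pow_right ⟨1, 1, by ring⟩
    refine h1.dvd_of_dvd_mul_left ?_
    exact ⟨X * minpoly K x, by rw [← hg]; ring⟩
  have he : aeval x (u * X ^ k) * x = aeval x (u * X ^ (k + 1)) := by
    rw [pow_succ, ← mul_assoc, map_mul _ (u * X ^ k), aeval_X]
  have h0 : aeval x (X ^ (k + 1) * g) = 0 := by
    rw [← hg, map_mul, minpoly.aeval, mul_zero]
  refine ⟨u * X ^ k, v * q, ?_, ?_⟩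
  · rw [he, ← map_mul, ← sub_eq_zero, ← map_sub]
    have : u * X ^ (k + 1) * (u * X ^ (k + 1)) - u * X ^ (k + 1)
        = -(u * v) * (X ^ (k + 1) * g) := by
      linear_combination (u * X ^ (k + 1)) * huv
    rw [this, map_mul, h0, mul_zero]
  · have h1 : (1 : End K V) - x = aeval x (1 - X : K[X]) := by simp
    rw [he, h1, ← map_mul]
    have : v * q * (1 - X) = 1 - u * X ^ (k + 1) := by
      linear_combination huv - v * hq
    rw [this, map_sub, map_one]

variable [IsAlgClosed K] [FiniteDimensional K V]

/-- A two-sided ideal of the algebra generated by `T` contains an element which acts as `1` on all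
simple factors that the ideal does not annihilate. -/
lemma exists_uniform_one (I : AddSubmonoid (End K V)) (hI : ∀ x ∈ I, x ∈ Algebra.adjoin K T)
    (hl : ∀ g ∈ Algebra.adjoin K T, ∀ y ∈ I, g * y ∈ I)
    (hr : ∀ g ∈ Algebra.adjoin K T, ∀ y ∈ I, y * g ∈ I)
    (ha : StableUnder T a) (hb : StableUnder T b) (hab : a ≤ b) :
    ∃ x ∈ I, ∀ c d, a ≤ c → d ≤ b → IsSimpleFactor T c d →
      (∀ y ∈ I, d ≤ c.comap y) ∨ d ≤ c.comap (1 - x) := by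
  induction b using WellFoundedLT.induction with
  | ind b ih =>
    rcases hab.eq_or_lt with rfl | hlt
    · exact ⟨0, zero_mem I, fun c d h1 h2 h => absurd h.lt (h2.trans h1).not_gt⟩
    obtain ⟨w, haw, hw⟩ := IsSimpleFactor.exists_right ha hb hlt
    obtain ⟨x, hx, hxw⟩ := ih w hw.lt hw.stable_left haw
    obtain ⟨x', hx', hxb⟩ : ∃ x' ∈ I, (∀ y ∈ I, b ≤ w.comap y) ∨ b ≤ w.comap (1 - x') := by
      by_cases hall : ∀ y ∈ I, b ≤ w.comap y
      · exact ⟨0, zero_mem I, .inl hall⟩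
      · push Not at hall
        obtain ⟨y, hy, hyb⟩ := hall
        obtain ⟨x', hx', h⟩ := hw.exists_one_sub_le I hI hl hr hy hyb
        exact ⟨x', hx', .inr h⟩
    have h1x : ∀ z ∈ I, 1 - z ∈ Algebra.adjoin K T := fun z hz => sub_mem (one_mem _) (hI z hz)
    -- Chosen so that its complement is `(1 - x) * (1 - x')`: it vanishes on a factor as soon as `1
    -- - x` or `1 - x'` does.
    refine ⟨x + (1 - x) * x', add_mem hx (hl _ (h1x x hx) _ hx'), fun c d hac hdb h => ?_⟩
    have hmul : 1 - (x + (1 - x) * x') = (1 - x) * (1 - x') := by noncomm_ring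
    rw [hmul]
    have sc := fun z hz => h.stable_left.of_mem_adjoin (h1x z hz)
    have sd := fun z hz => h.stable_right.of_mem_adjoin (h1x z hz)
    -- A simple factor either is a copy of the top one `w < b` or is represented below `w` by `c ⊓ w
    -- < d ⊓ w`.
    by_cases hdw : d ⊓ w ≤ c
    · have hlt' : w < d ⊔ w := by
        refine lt_of_le_of_ne le_sup_right fun e => h.lt.not_ge ?_
        have : d ≤ w := e ▸ le_sup_left
        rwa [inf_eq_left.2 this] at hdw
      have hdwb : d ⊔ w = b :=
        hw.eq_of_lt (h.stable_right.sup hw.stable_left) hlt' (sup_le hdb hw.lt.le)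
      have hdb' : d ≤ b := hdb
      rcases hxb with hall | hone
      · left
        intro y hy v hv
        exact hdw ⟨h.stable_right.of_mem_adjoin (hI y hy) hv, hall y hy (hdb' hv)⟩
      · right
        intro v hv
        exact sc x hx (hdw ⟨sd x' hx' hv, hone (hdb' hv)⟩)
    · have hs := h.inf_of_not_le hw.stable_left hdw
      have hd : d ≤ c ⊔ d ⊓ w := by
        rcases h.eq_or_eq (c ⊔ d ⊓ w)
          (h.stable_left.sup hs.stable_right) le_sup_left (sup_le h.lt.le inf_le_left) with e | e
        · exact absurd (e ▸ le_sup_right) hdw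
        · exact e.ge
      rcases hxw (c ⊓ w) (d ⊓ w) (le_inf hac haw) inf_le_right hs with hall | hone
      · left
        intro y hy
        refine hd.trans (sup_le (h.stable_left.of_mem_adjoin (hI y hy)) ?_)
        exact (hall y hy).trans (comap_mono inf_le_left)
      · right
        have h2 : d ≤ c.comap (1 - x) :=
          hd.trans (sup_le (sc x hx) (hone.trans (comap_mono inf_le_left)))
        exact fun v hv => h2 (sd x' hx' hv)

/-- A two-sided ideal annihilating some but not all simple factors separates them. -/
lemma isSeparated_of_ideal (I : AddSubmonoid (End K V)) (hI : ∀ x ∈ I, x ∈ Algebra.adjoin K T)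
    (hl : ∀ g ∈ Algebra.adjoin K T, ∀ y ∈ I, g * y ∈ I)
    (hr : ∀ g ∈ Algebra.adjoin K T, ∀ y ∈ I, y * g ∈ I)
    (ha : StableUnder T a) (hb : StableUnder T b)
    (h : IsSimpleFactor T c d) (hac : a ≤ c) (hdb : d ≤ b) (hk : ∀ y ∈ I, d ≤ c.comap y)
    {c' d' : Submodule K V} (h' : IsSimpleFactor T c' d') (hac' : a ≤ c') (hdb' : d' ≤ b)
    {y : End K V} (hy : y ∈ I) (hyd : ¬ d' ≤ c'.comap y) : IsSeparated T a b := by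
  obtain ⟨x, hx, hx1⟩ := exists_uniform_one I hI hl hr ha hb (hac.trans (h.lt.le.trans hdb))
  obtain ⟨p, q, hidem, hq⟩ := exists_idempotent_aeval x
  have hmem : ∀ r : Polynomial K, Polynomial.aeval x r ∈ Algebra.adjoin K T := fun r =>
    Algebra.adjoin_le (Set.singleton_subset_iff.2 (hI x hx))
      (Polynomial.aeval_mem_adjoin_singleton K x)
  have heI : Polynomial.aeval x p * x ∈ I := hl _ (hmem p) _ hx
  set e := Polynomial.aeval x p * x
  have key : ∀ c d, a ≤ c → d ≤ b → IsSimpleFactor T c d →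
      (∀ y ∈ I, d ≤ c.comap y) ∨ d ≤ c.comap (1 - e) := by
    intro c d hac hdb h
    refine (hx1 c d hac hdb h).imp_right fun h1 => ?_
    rw [hq]
    exact fun v hv => h.stable_left.of_mem_adjoin (hmem q) (h1 hv)
  refine ⟨e, hI e heI, hidem, fun hbe => ?_, fun hbe => ?_, fun c d hac hdb h =>
    (key c d hac hdb h).imp_left fun hall => hall e heI⟩
  · rcases key c' d' hac' hdb' h' with hall | hone
    · exact hyd (hall y hy)
    · refine h'.lt.not_ge fun v hv => ?_
      have := c'.add_mem (hone hv) (hac' (hbe (hdb' hv)))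
      simpa using this
  · refine h.lt.not_ge fun v hv => ?_
    have := c.add_mem (hac (hbe (hdb hv))) (hk e heI hv)
    simpa using this

/-- The operators in the algebra generated by `T` that annihilate all factors in `P`. -/
def factorAnnihilator (T : Set (End K V)) (P : Set (Submodule K V × Submodule K V)) :
    AddSubmonoid (End K V) where
  carrier := {x | x ∈ Algebra.adjoin K T ∧ ∀ p ∈ P, p.2 ≤ p.1.comap x}
  add_mem' hx hy := ⟨add_mem hx.1 hy.1, fun p hp _ hv =>
    p.1.add_mem (hx.2 p hp hv) (hy.2 p hp hv)⟩
  zero_mem' := ⟨zero_mem _, fun p _ _ _ => p.1.zero_mem⟩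

/-- If some operator annihilates a simple factor together with all factors in `P`, but not another
simple factor, then `T` separates. -/
lemma isSeparated_of_annihilator {P : Set (Submodule K V × Submodule K V)}
    (hP : ∀ p ∈ P, StableUnder T p.1 ∧ StableUnder T p.2)
    (ha : StableUnder T a) (hb : StableUnder T b)
    (h : IsSimpleFactor T c d) (hac : a ≤ c) (hdb : d ≤ b) (hk : (c, d) ∈ P)
    {c' d' : Submodule K V} (h' : IsSimpleFactor T c' d') (hac' : a ≤ c') (hdb' : d' ≤ b)
    {y : End K V} (hyT : y ∈ Algebra.adjoin K T) (hy : ∀ p ∈ P, p.2 ≤ p.1.comap y)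
    (hyd : ¬ d' ≤ c'.comap y) : IsSeparated T a b :=
  isSeparated_of_ideal (factorAnnihilator T P) (fun _ hx => hx.1)
    (fun _ hg _ hy => ⟨mul_mem hg hy.1, fun p hp _ hv =>
      (hP p hp).1.of_mem_adjoin hg (hy.2 p hp hv)⟩)
    (fun _ hg _ hy => ⟨mul_mem hy.1 hg, fun p hp _ hv =>
      hy.2 p hp ((hP p hp).2.of_mem_adjoin hg hv)⟩)
    ha hb h hac hdb (fun _ hy => hy.2 _ hk) h' hac' hdb' ⟨hyT, hy⟩ hyd

/-- Let `T` not separate `a` and `b`. If an idempotent of the algebra generated by `T` acts neither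
as `0` nor as `1` on some simple factor, then it does so on no simple factor. -/
lemma forall_not_of_not_isSeparated (hsep : ¬ IsSeparated T a b) (ha : StableUnder T a)
    (hb : StableUnder T b) {e : End K V} (he : e ∈ Algebra.adjoin K T)
    (h : IsSimpleFactor T c d) (hac : a ≤ c) (hdb : d ≤ b) (h0 : ¬ d ≤ c.comap e)
    (h1 : ¬ d ≤ c.comap (1 - e)) {c' d' : Submodule K V} (h' : IsSimpleFactor T c' d')
    (hac' : a ≤ c') (hdb' : d' ≤ b) : ¬ d' ≤ c'.comap e ∧ ¬ d' ≤ c'.comap (1 - e) := by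
  by_contra hcon
  have hcon' : d' ≤ c'.comap e ∨ d' ≤ c'.comap (1 - e) := by tauto
  have h1e : 1 - e ∈ Algebra.adjoin K T := sub_mem (one_mem _) he
  obtain ⟨v, hv, hve⟩ : ∃ v ∈ d, e v ∉ c := by simpa [SetLike.le_def] using h0
  obtain ⟨w, hw, hwe⟩ : ∃ w ∈ d, (1 - e) w ∉ c := by
    simpa only [SetLike.le_def, not_forall, exists_prop, mem_comap] using h1
  obtain ⟨x, hx, hxv⟩ := h.exists_apply_sub_mem (h.stable_right.of_mem_adjoin he hv) hve hw
  -- The operator `(1 - e) * x * e` vanishes wherever `e` is `0` or `1`, but sends `v` to `(1 - e)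
  -- w`, nonzero modulo `c`. The ideal of operators killing all factors of the first kind thus
  -- separates.
  refine hsep (isSeparated_of_annihilator
    (P := {p | IsSimpleFactor T p.1 p.2 ∧ (p.2 ≤ p.1.comap e ∨ p.2 ≤ p.1.comap (1 - e))})
    (fun p hp => ⟨hp.1.stable_left, hp.1.stable_right⟩) ha hb h' hac' hdb' ⟨h', hcon'⟩ h hac hdb
    (y := (1 - e) * x * e) (mul_mem (mul_mem h1e hx) he) ?_ fun hle => ?_)
  · rintro ⟨c, d⟩ ⟨hcd, hor⟩ v hv
    rcases hor with h0 | h1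
    · exact hcd.stable_left.of_mem_adjoin (mul_mem h1e hx) (h0 hv)
    · exact h1 (hcd.stable_right.of_mem_adjoin (mul_mem hx he) hv)
  · have h2 : (1 - e) (x (e v)) ∈ c := hle hv
    have h3 := h.stable_left.of_mem_adjoin h1e hxv
    rw [mem_comap, map_sub] at h3
    exact hwe (by simpa using c.sub_mem h2 h3)

end Separation

/-! ### Bounding irredundant families by length -/

section Counting

variable {K V : Type*} [Field K] [AddCommGroup V] [Module K V] {T T' : Set (End K V)}
  {a b c d M : Submodule K V}

/-- Only stable subspaces are compared, so `T` and `T'` need not be nested; this permits replacing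
operators by products with an idempotent and back. -/
lemma IsSimpleFactor.of_imp (h : IsSimpleFactor T c d)
    (hT : ∀ W, StableUnder T' W → StableUnder T W) (hc : StableUnder T' c)
    (hd : StableUnder T' d) : IsSimpleFactor T' c d :=
  ⟨h.lt, hc, hd, fun W hW => h.eq_or_eq W (hT W hW)⟩

variable [FiniteDimensional K V]

/-- An irredundant family of operators destroying all `T`-stable subspaces between `a` and `M` has
at most as many members as a `T`-stable chain from `a` to `M`. -/
lemma card_le_stableLength_of_irredundant (Q : Finset (End K V)) (ha : StableUnder T a)
    (haQ : StableUnder (Q : Set (End K V)) a) (hM : StableUnder T M) (haM : a ≤ M)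
    (hno : ∀ W, StableUnder (T ∪ Q) W → a ≤ W → W ≤ M → W = a)
    (hd : ∀ s ∈ Q, ∃ d, a < d ∧ d ≤ M ∧ StableUnder (T ∪ (↑Q \ {s})) d) :
    Q.card ≤ stableLength T a M := by
  classical
  induction hn : Q.card generalizing Q T M with
  | zero => exact Nat.zero_le _
  | succ n ih =>
    obtain ⟨s, hs⟩ : Q.Nonempty := Finset.card_pos.1 (by omega)
    obtain ⟨d, had, hdM, -⟩ := hd s hs
    obtain ⟨q, hq, hqM⟩ : ∃ q ∈ Q, ¬ M ≤ M.comap q := by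
      by_contra! hcon
      have := hno M (hM.union hcon) haM le_rfl
      exact (had.trans_le hdM).ne' this
    have hqT : insert q T ∪ (Q.erase q : Set (End K V)) = T ∪ Q := by
      rw [Finset.coe_erase, Set.insert_union, ← Set.union_insert, Set.insert_sdiff_singleton,
        Set.insert_eq_of_mem (Finset.mem_coe.2 hq)]
    -- The largest part of `M` stable under `q` as well. It is strictly smaller, so adding `q` to
    -- `T` costs at least one unit of length, while the witnesses for the other operators are stable
    -- under `q` and survive inside `M'`.
    set M' : Submodule K V := sSup {W | StableUnder (insert q T) W ∧ W ≤ M}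
    have hM' : StableUnder (insert q T) M' := StableUnder.sSup fun W hW => hW.1
    have hM'M : M' ≤ M := sSup_le fun W hW => hW.2
    have hle : ∀ W, StableUnder (insert q T) W → W ≤ M → W ≤ M' := fun W h1 h2 =>
      le_sSup ⟨h1, h2⟩
    have ha' : StableUnder (insert q T) a := ha.insert (haQ q hq)
    have haM' : a ≤ M' := hle a ha' haM
    have hlt : M' < M := hM'M.lt_of_ne fun e => hqM (by
      have := hM' q (Set.mem_insert q T)
      rwa [e] at this)
    have h1 := ih (Q.erase q) ha' (haQ.anti (by simp)) hM' haM'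
      (fun W hW h1 h2 => hno W (hqT ▸ hW) h1 (h2.trans hM'M))
      (fun s hs => by
        obtain ⟨hsq, hsQ⟩ := Finset.mem_erase.1 hs
        obtain ⟨d, h1, h2, h3⟩ := hd s hsQ
        refine ⟨d, h1, hle d (h3.anti ?_) h2, h3.anti ?_⟩
        · rintro f (rfl | hf)
          · exact .inr ⟨hq, fun e => hsq e.symm⟩
          · exact .inl hf
        · rintro f ((rfl | hf) | ⟨hf, hfs⟩)
          · exact .inr ⟨hq, fun e => hsq e.symm⟩
          · exact .inl hf
          · exact .inr ⟨Finset.mem_of_mem_erase hf, hfs⟩)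
      (by rw [Finset.card_erase_of_mem hq]; omega)
    have h2 := stableLength_anti (Set.subset_insert q T) ha' hM' haM'
    have h3 := stableLength_lt_of_lt_right ha (hM'.anti (Set.subset_insert q T)) hM haM' hlt
    omega

/-- Subspaces `D s` and operators `y s` with `y t (D s) ≤ c` exactly for `s ≠ t` are independent
modulo `c`. -/
lemma card_le_stableLength_of_dual (R : Finset (End K V)) (D : End K V → Submodule K V)
    (y : End K V → End K V) (hc : StableUnder T c) (hd : StableUnder T d) (hcd : c ≤ d)
    (hD : ∀ s ∈ R, StableUnder T (D s)) (hDd : ∀ s ∈ R, D s ≤ d)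
    (hyc : ∀ s ∈ R, c ≤ c.comap (y s))
    (hyD : ∀ s ∈ R, ∀ t ∈ R, t ≠ s → D s ≤ c.comap (y t))
    (hys : ∀ s ∈ R, ¬ D s ≤ c.comap (y s)) : R.card ≤ stableLength T c d := by
  classical
  -- The subspaces `D s` are joined one at a time. Operators not yet used still kill the join modulo
  -- `c`, so each new `D s` is not contained in it and the length grows.
  suffices h : ∀ Q ⊆ R, ∃ W, StableUnder T W ∧ c ≤ W ∧ W ≤ d ∧ Q.card ≤ stableLength T c W ∧
      ∀ t ∈ R, t ∉ Q → W ≤ c.comap (y t) by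
    obtain ⟨W, hW, h1, h2, h3, -⟩ := h R subset_rfl
    exact h3.trans ((Nat.le_add_right _ _).trans (stableLength_add_le hc hW hd h1 h2))
  intro Q
  induction Q using Finset.induction_on with
  | empty => exact fun _ => ⟨c, hc, le_rfl, hcd, Nat.zero_le _, fun t ht _ => hyc t ht⟩
  | insert s Q hs ih =>
    intro hQ
    have hsR : s ∈ R := hQ (Finset.mem_insert_self s Q)
    obtain ⟨W, hW, h1, h2, h3, h4⟩ := ih ((Finset.subset_insert s Q).trans hQ)
    have hlt : W < W ⊔ D s := lt_of_le_of_ne le_sup_left fun e =>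
      hys s hsR ((e ▸ le_sup_right : D s ≤ W).trans (h4 s hsR hs))
    refine ⟨W ⊔ D s, hW.sup (hD s hsR), h1.trans le_sup_left, sup_le h2 (hDd s hsR), ?_,
      fun t ht htQ => ?_⟩
    · rw [Finset.card_insert_of_notMem hs]
      exact h3.trans_lt (stableLength_lt_of_lt_right hc hW (hW.sup (hD s hsR)) h1 hlt)
    · rw [Finset.mem_insert, not_or] at htQ
      exact sup_le (h4 t ht htQ.2) (hyD s hsR t ht htQ.1)

/-- In an irredundant irreducible family `S` of operators, each vanishing on the image of `g` or of
`1 - g`, the number of those that vanish on the image of `1 - g` is bounded by the length. -/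
lemma card_lt_stableLength_of_source (S Q : Finset (End K V)) {g : End K V}
    (hg : g ∈ Algebra.adjoin K T) (h : IsSimpleFactor (T ∪ S) a b)
    (hmin : ∀ s ∈ S, ¬ IsSimpleFactor (T ∪ (↑S \ {s})) a b)
    (hd : ∀ s ∈ S, ∀ d ≤ b, d ≠ b → IsSimpleFactor (T ∪ (↑S \ {s})) a d →
      d ≤ a.comap g ∨ d ≤ a.comap (1 - g))
    (hb : ¬ b ≤ a.comap (1 - g)) (hs : ∀ s ∈ S, s * g = s ∨ s * g = 0)
    (hQ : ∀ s, s ∈ Q ↔ s ∈ S ∧ s * g = s) : Q.card < stableLength T a b := by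
  have haT : StableUnder T a := h.stable_left.anti Set.subset_union_left
  have hbT : StableUnder T b := h.stable_right.anti Set.subset_union_left
  have haS : StableUnder (S : Set (End K V)) a := h.stable_left.anti Set.subset_union_right
  have hQS : (Q : Set (End K V)) ⊆ S := fun s hs => ((hQ s).1 hs).1
  -- The largest `T`-stable subspace of `b` on which `g` acts as the identity modulo `a`. Operators
  -- outside `Q` send it into `a`, so only `Q` breaks up the interval from `a` to `M`.
  set M : Submodule K V := sSup {W | StableUnder T W ∧ W ≤ b ∧ W ≤ a.comap (1 - g)}
  have hM : StableUnder T M := StableUnder.sSup fun W hW => hW.1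
  have hMb : M ≤ b := sSup_le fun W hW => hW.2.1
  have hMg : M ≤ a.comap (1 - g) := sSup_le fun W hW => hW.2.2
  have hle : ∀ W, StableUnder T W → W ≤ b → W ≤ a.comap (1 - g) → W ≤ M := fun W h1 h2 h3 =>
    le_sSup ⟨h1, h2, h3⟩
  have haM : a ≤ M := hle a haT h.lt.le (haT.of_mem_adjoin (sub_mem (one_mem _) hg))
  have hlt : M < b := hMb.lt_of_ne fun e => hb (by rwa [e] at hMg)
  refine (card_le_stableLength_of_irredundant Q haT (haS.anti hQS) hM haM ?_ ?_).trans_lt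
    (stableLength_lt_of_lt_right haT hM hbT haM hlt)
  · intro W hW haW hWM
    refine (h.eq_or_eq W ((hW.anti Set.subset_union_left).union fun s hsS v hv => ?_) haW
      (hWM.trans hMb)).resolve_right fun e => hlt.not_ge (e ▸ hWM)
    by_cases hsQ : s ∈ Q
    · exact hW s (.inr hsQ) hv
    · have hsg : s * g = 0 := (hs s hsS).resolve_left fun e => hsQ ((hQ s).2 ⟨hsS, e⟩)
      have h0 : s (g v) = 0 := congrArg (fun f : End K V => f v) hsg
      have : s v = s ((1 - g) v) := by simp [h0]
      rw [mem_comap, this]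
      exact haW (haS s hsS (hMg (hWM hv)))
  · intro s hsQ
    obtain ⟨hsS, hsg⟩ := (hQ s).1 hsQ
    obtain ⟨d, hdb, hds⟩ := IsSimpleFactor.exists_left
      (h.stable_left.anti (Set.union_subset_union_right T (Set.sdiff_subset (t := {s}))))
      (h.stable_right.anti (Set.union_subset_union_right T (Set.sdiff_subset (t := {s})))) h.lt
    have hne : d ≠ b := fun e => hmin s hsS (e ▸ hds)
    have hdT : StableUnder T d := hds.stable_right.anti Set.subset_union_left
    refine ⟨d, hds.lt, hle d hdT hdb ((hd s hsS d hdb hne hds).resolve_left fun hdg => ?_),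
      hds.stable_right.anti (Set.union_subset_union_right T (Set.sdiff_subset_sdiff_left hQS))⟩
    -- If `g` were `0` on `d` modulo `a`, then `s = s * g` would map `d` into `a`, and `s` would not
    -- be needed to destroy `d`.
    have hsd : d ≤ d.comap s := fun v hv => by
      have h1 := haS s hsS (hdg hv)
      have : s (g v) = s v := congrArg (fun f : End K V => f v) hsg
      rw [mem_comap, this] at h1
      exact hds.lt.le h1
    have hdS : StableUnder (T ∪ S) d := hdT.union fun t ht => by
      by_cases e : t = s
      · exact e ▸ hsd
      · exact hds.stable_right t (.inr ⟨ht, e⟩)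
    exact hne (h.eq_of_lt hdS hds.lt hdb)

end Counting

/-! ### The inductive bound on subfamilies -/

section SmallSubsets

variable {K V : Type*} [Field K] [AddCommGroup V] [Module K V] {T T' : Set (End K V)}
  {a b c d M : Submodule K V}

/-- Every finite set `S` of operators making a factor of `T`-length `N` simple contains a subset of
at most `2N - 1` operators doing so, and one of at most `2N - 2` operators if `T` separates. -/
def HasSmallSubsets (K V : Type*) [Field K] [AddCommGroup V] [Module K V] (N : ℕ) : Prop :=
  ∀ (T : Set (End K V)) (S : Finset (End K V)) (a b : Submodule K V), stableLength T a b = N →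
    IsSimpleFactor (T ∪ S) a b →
      (∃ R ⊆ S, R.card + 1 ≤ 2 * N ∧ IsSimpleFactor (T ∪ R) a b) ∧
      (IsSeparated T a b → ∃ R ⊆ S, R.card + 2 ≤ 2 * N ∧ IsSimpleFactor (T ∪ R) a b)

variable [IsAlgClosed K] [FiniteDimensional K V]

/-- The bound for a separating idempotent `e ∈ T` and operators that vanish on the image of `e` or
of `1 - e`. -/
lemma exists_small_subset_of_sources {N : ℕ} (ih : ∀ m < N, HasSmallSubsets K V m)
    {e : End K V} (he : e ∈ T) (hidem : e * e = e) (h0 : ¬ b ≤ a.comap e)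
    (h1 : ¬ b ≤ a.comap (1 - e))
    (hT : ∀ c d, a ≤ c → d ≤ b → IsSimpleFactor T c d → d ≤ c.comap e ∨ d ≤ c.comap (1 - e))
    (S : Finset (End K V)) (hs : ∀ s ∈ S, s * e = s ∨ s * e = 0) (hN : stableLength T a b = N)
    (h : IsSimpleFactor (T ∪ S) a b) :
    ∃ R ⊆ S, R.card + 2 ≤ 2 * N ∧ IsSimpleFactor (T ∪ R) a b := by
  classical
  have heT : e ∈ Algebra.adjoin K T := Algebra.subset_adjoin he
  have haT : StableUnder T a := h.stable_left.anti Set.subset_union_left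
  have hbT : StableUnder T b := h.stable_right.anti Set.subset_union_left
  -- Whether some subset of `S` makes simple a proper subinterval on which `e` is neither `0` nor
  -- `1`.
  by_cases hA : ∃ R ⊆ S, ∃ c d, a ≤ c ∧ d ≤ b ∧ ¬ (c = a ∧ d = b) ∧ IsSimpleFactor (T ∪ R) c d ∧
      ¬ d ≤ c.comap e ∧ ¬ d ≤ c.comap (1 - e)
  · obtain ⟨R, hRS, c, d, hac, hdb, hne, hcd, hd0, hd1⟩ := hA
    have hcT : StableUnder T c := hcd.stable_left.anti Set.subset_union_left
    have hdT : StableUnder T d := hcd.stable_right.anti Set.subset_union_left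
    have two_le : ∀ {c d : Submodule K V}, a ≤ c → d ≤ b → c < d → StableUnder T c →
        StableUnder T d → ¬ d ≤ c.comap e → ¬ d ≤ c.comap (1 - e) → 2 ≤ stableLength T c d := by
      intro c d hac hdb hlt hc hd hd0 hd1
      by_contra hcon
      rcases hT c d hac hdb (.of_stableLength_le_one hc hd hlt (by omega)) with h | h
      exacts [hd0 h, hd1 h]
    have hl2 := two_le hac hdb hcd.lt hcT hdT hd0 hd1
    have hlN := stableLength_lt_of_ne haT hbT hcT hdT hac hcd.lt.le hdb hne
    obtain ⟨R₁, hR₁, hc₁, hs₁⟩ := (ih _ (hN ▸ hlN) T R c d rfl hcd).2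
      ⟨e, heT, hidem, hd0, hd1, fun c' d' h1 h2 => hT c' d' (hac.trans h1) (h2.trans hdb)⟩
    have hTT₁ : T ⊆ T ∪ (R₁ : Set (End K V)) := Set.subset_union_left
    have hR₁S : R₁ ⊆ S := hR₁.trans hRS
    have hsub : T ∪ (R₁ : Set (End K V)) ⊆ T ∪ S :=
      Set.union_subset_union_right T (Finset.coe_subset.2 hR₁S)
    have ha₁ := h.stable_left.anti hsub
    have hb₁ := h.stable_right.anti hsub
    have hle := hs₁.stableLength_add_le_of_subset hTT₁ ha₁ hb₁ hac hdb
    have hbig : IsSimpleFactor (T ∪ (R₁ : Set (End K V)) ∪ S) a b :=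
      h.of_stable (Set.union_subset_union_left _ hTT₁)
        (ha₁.union (h.stable_left.anti Set.subset_union_right))
        (hb₁.union (h.stable_right.anti Set.subset_union_right))
    -- With `l` the `T`-length from `c` to `d`, `R₁` has at most `2l - 2` members and the length
    -- left is at most `N - l + 1`. If separation persists, the total is at most `2l - 2 + 2(N - l +
    -- 1) - 2 = 2N - 2`.
    obtain ⟨hne1, hsep1⟩ := ih _ (by omega) _ S a b rfl hbig
    by_cases hsep : IsSeparated (T ∪ (R₁ : Set (End K V))) a b
    · obtain ⟨R₂, hR₂, hc₂, hs₂⟩ := hsep1 hsep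
      refine ⟨R₁ ∪ R₂, Finset.union_subset hR₁S hR₂, ?_, ?_⟩
      · have := Finset.card_union_le R₁ R₂
        omega
      · rwa [Finset.coe_union, ← Set.union_assoc]
    · obtain ⟨R₂, hR₂, hc₂, hs₂⟩ := hne1
      refine ⟨R₁ ∪ R₂, Finset.union_subset hR₁S hR₂, ?_, ?_⟩
      -- Here induction costs one more. But `e` is neither `0` nor `1` from `c` to `d`, hence on no
      -- simple factor, so every simple factor of `T ∪ R₁` has `T`-length at least two. Lengths
      -- outside `c < d` have therefore at least halved, and the subinterval being proper, this more
      -- than covers the extra operator.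
      · have hbad : ∀ c' d', a ≤ c' → d' ≤ b → IsSimpleFactor (T ∪ (R₁ : Set (End K V))) c' d' →
            2 ≤ stableLength T c' d' := by
          intro c' d' h1 h2 hcd'
          obtain ⟨h3, h4⟩ := forall_not_of_not_isSeparated hsep ha₁ hb₁
            (Algebra.adjoin_mono hTT₁ heT) hs₁ hac hdb hd0 hd1 hcd' h1 h2
          exact two_le h1 h2 hcd'.lt (hcd'.stable_left.anti hTT₁) (hcd'.stable_right.anti hTT₁)
            h3 h4
        have g1 := two_mul_stableLength_le hTT₁ ha₁
          (fun c' d' h1 h2 => hbad c' d' h1 (h2.trans (hcd.lt.le.trans hdb))) hs₁.stable_left hac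
        have g2 := two_mul_stableLength_le hTT₁ hs₁.stable_right
          (fun c' d' h1 => hbad c' d' ((hac.trans hcd.lt.le).trans h1)) hb₁ hdb
        have g3 := stableLength_le_add ha₁ hs₁.stable_left hb₁ hac (hcd.lt.le.trans hdb)
        have g4 := stableLength_le_add hs₁.stable_left hs₁.stable_right hb₁ hcd.lt.le hdb
        have g5 := hs₁.stableLength_eq_one
        have g6 := stableLength_mono_interval haT hbT hcT hdT hac hcd.lt.le hdb
        have g7 := stableLength_lt_of_ne ha₁ hb₁ hs₁.stable_left hs₁.stable_right hac hcd.lt.le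
          hdb hne
        have := Finset.card_union_le R₁ R₂
        omega
      · rwa [Finset.coe_union, ← Set.union_assoc]
  · push Not at hA
    obtain ⟨R, ⟨hRS, hR⟩, hmin⟩ := WellFounded.has_min (wellFounded_lt (α := Finset (End K V)))
      {R | R ⊆ S ∧ IsSimpleFactor (T ∪ R) a b} ⟨S, subset_rfl, h⟩
    refine ⟨R, hRS, ?_, hR⟩
    have hmin' : ∀ s ∈ R, ¬ IsSimpleFactor (T ∪ (↑R \ {s})) a b := fun s hs hsim =>
      hmin (R.erase s) ⟨(Finset.erase_subset s R).trans hRS, by rwa [Finset.coe_erase]⟩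
        (Finset.erase_ssubset hs)
    have hd : ∀ s ∈ R, ∀ d ≤ b, d ≠ b → IsSimpleFactor (T ∪ (↑R \ {s})) a d →
        d ≤ a.comap e ∨ d ≤ a.comap (1 - e) := by
      intro s hs d hdb hne hds
      rw [← Finset.coe_erase] at hds
      have := hA (R.erase s) ((Finset.erase_subset s R).trans hRS) a d le_rfl hdb
        (fun _ => hne) hds
      tauto
    -- The two kinds of operators are counted separately, with `g = e` and with `g = 1 - e`; each
    -- count is below `N`.
    have k1 := card_lt_stableLength_of_source R (R.filter fun s => s * e = s) heT hR hmin' hd h1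
      (fun s hsR => hs s (hRS hsR)) (fun s => Finset.mem_filter)
    have k2 := card_lt_stableLength_of_source R (R.filter fun s => s * (1 - e) = s) (g := 1 - e)
      (sub_mem (one_mem _) heT) hR hmin'
      (fun s hs d h1 h2 h3 => by rw [sub_sub_cancel]; exact (hd s hs d h1 h2 h3).symm)
      (by rwa [sub_sub_cancel])
      (fun s hsR => by
        rw [mul_sub, mul_one]
        rcases hs s (hRS hsR) with h | h
        · right; rw [h, sub_self]
        · left; rw [h, sub_zero]) (fun s => Finset.mem_filter)
    have hcover : R = (R.filter fun s => s * e = s) ∪ (R.filter fun s => s * (1 - e) = s) := by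
      ext s
      simp only [Finset.mem_union, Finset.mem_filter]
      constructor
      · intro hsR
        rcases hs s (hRS hsR) with h | h
        · exact .inl ⟨hsR, h⟩
        · exact .inr ⟨hsR, by rw [mul_sub, mul_one, h, sub_zero]⟩
      · tauto
    have k3 := Finset.card_union_le (R.filter fun s => s * e = s)
      (R.filter fun s => s * (1 - e) = s)
    rw [← hcover] at k3
    omega

/-- The bound in the separated case. -/
lemma exists_small_subset_of_isSeparated {N : ℕ} (ih : ∀ m < N, HasSmallSubsets K V m)
    (hN : stableLength T a b ≤ N) (hsep : IsSeparated T a b)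
    (S : Finset (End K V)) (h : IsSimpleFactor (T ∪ S) a b) :
    ∃ R ⊆ S, R.card + 2 ≤ 2 * N ∧ IsSimpleFactor (T ∪ R) a b := by
  classical
  obtain ⟨e, he, hidem, h0, h1, hfac⟩ := hsep
  have hins : ∀ W, StableUnder (insert e T) W ↔ StableUnder T W := fun W =>
    ⟨fun hW => hW.anti (Set.subset_insert e T), fun hW => hW.insert (hW.of_mem_adjoin he)⟩
  have haT := h.stable_left.anti Set.subset_union_left
  have hbT := h.stable_right.anti Set.subset_union_left
  have haS : StableUnder (S : Set (End K V)) a := h.stable_left.anti Set.subset_union_right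
  have hbS : StableUnder (S : Set (End K V)) b := h.stable_right.anti Set.subset_union_right
  -- Since `s = s * e + s * (1 - e)`, these products have the same effect on subspaces stable under
  -- `e`.
  let S' : Finset (End K V) := S.image (· * e) ∪ S.image (· * (1 - e))
  have hS' : ∀ r ∈ S', ∃ s ∈ S, r = s * e ∨ r = s * (1 - e) := by
    intro r hr
    rcases Finset.mem_union.1 hr with hr | hr <;> obtain ⟨s, hs, rfl⟩ := Finset.mem_image.1 hr
    exacts [⟨s, hs, .inl rfl⟩, ⟨s, hs, .inr rfl⟩]
  have hstab : ∀ W, StableUnder T W → ∀ s : End K V, W ≤ W.comap s → ∀ r : End K V,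
      r = s * e ∨ r = s * (1 - e) → W ≤ W.comap r := by
    rintro W hW s hs r (rfl | rfl) v hv
    · exact hs (hW.of_mem_adjoin he hv)
    · exact hs (hW.of_mem_adjoin (sub_mem (one_mem _) he) hv)
  have hstab' : ∀ W, StableUnder T W → StableUnder (S : Set (End K V)) W →
      StableUnder (S' : Set (End K V)) W := by
    intro W hW hWS r hr
    obtain ⟨s, hs, hrs⟩ := hS' r hr
    exact hstab W hW s (hWS s hs) r hrs
  have hsim : IsSimpleFactor (insert e T ∪ S') a b := by
    refine h.of_imp (fun W hW => ?_) (((hins a).2 haT).union (hstab' a haT haS))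
      (((hins b).2 hbT).union (hstab' b hbT hbS))
    refine ((hins W).1 (hW.anti Set.subset_union_left)).union fun s hs v hv => ?_
    have m1 : s * e ∈ S' := Finset.mem_union_left _ (Finset.mem_image_of_mem _ hs)
    have m2 : s * (1 - e) ∈ S' := Finset.mem_union_right _ (Finset.mem_image_of_mem (· * (1 - e)) hs)
    have := W.add_mem (hW _ (.inr m1) hv) (hW _ (.inr m2) hv)
    simpa [mul_sub] using this
  have hlen : stableLength (insert e T) a b ≤ N :=
    (stableLength_anti (Set.subset_insert e T) ((hins a).2 haT) ((hins b).2 hbT) h.lt.le).trans hN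
  obtain ⟨R', hR', hcard, hR's⟩ := exists_small_subset_of_sources
    (N := stableLength (insert e T) a b) (fun m hm => ih m (hm.trans_le hlen))
    (Set.mem_insert e T) hidem h0 h1
    (fun c d h1 h2 h3 => hfac c d h1 h2 ((IsSimpleFactor.congr hins).1 h3)) S'
    (fun r hr => by
      obtain ⟨s, -, rfl | rfl⟩ := hS' r hr
      · left; rw [mul_assoc, hidem]
      · right; rw [mul_assoc, sub_mul, one_mul, hidem, sub_self, mul_zero]) rfl hsim
  -- Each chosen product is traced back to a member of `S`, without increasing the count.
  choose! φ hφ using hS'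
  refine ⟨R'.image φ, ?_, ?_, ?_⟩
  · intro s hs
    obtain ⟨r, hr, rfl⟩ := Finset.mem_image.1 hs
    exact (hφ r (hR' hr)).1
  · have := Finset.card_image_le (s := R') (f := φ)
    omega
  · have hsub : (R'.image φ : Set (End K V)) ⊆ S := by
      intro s hs
      obtain ⟨r, hr, rfl⟩ := Finset.mem_image.1 (Finset.mem_coe.1 hs)
      exact (hφ r (hR' hr)).1
    refine hR's.of_imp (fun W hW => ?_) (haT.union (haS.anti hsub)) (hbT.union (hbS.anti hsub))
    have hWT := hW.anti Set.subset_union_left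
    refine ((hins W).2 hWT).union fun r hr => ?_
    exact hstab W hWT (φ r) (hW _ (.inr (Finset.mem_coe.2 (Finset.mem_image_of_mem φ hr)))) r
      (hφ r (hR' hr)).2

/-- If adding `s` neither separates nor decreases the length, then `s` acts on all simple factors
as one element of the algebra generated by `T`. -/
lemma exists_sub_annihilates {s : End K V} (haT : StableUnder (insert s T) a)
    (hbT : StableUnder (insert s T) b) (hab : a < b) (hsep : ¬ IsSeparated (insert s T) a b)
    (hlen : stableLength T a b ≤ stableLength (insert s T) a b) :
    ∃ x ∈ Algebra.adjoin K T, ∀ c d, a ≤ c → d ≤ b → IsSimpleFactor (insert s T) c d →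
      d ≤ c.comap (s - x) := by
  obtain ⟨d₀, hd₀b, hd₀⟩ := IsSimpleFactor.exists_left haT hbT hab
  have hsub := Set.subset_insert s T
  have := hd₀.stableLength_add_le_of_subset hsub haT hbT le_rfl hd₀b
  have hs₀ : IsSimpleFactor T a d₀ :=
    -- Had `d₀` larger `T`-length over `a`, adding `s` would shorten the whole interval. So `a < d₀`
    -- is already simple for `T`, and density supplies `x`; any factor not killed by `s - x` would
    -- then separate.
    .of_stableLength_le_one (haT.anti hsub) (hd₀.stable_right.anti hsub) hd₀.lt (by omega)
  obtain ⟨x, hx, hxd⟩ := hs₀.exists_sub_le (hd₀.stable_left s (Set.mem_insert s T))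
    (hd₀.stable_right s (Set.mem_insert s T))
  refine ⟨x, hx, fun c d hac hdb hcd => ?_⟩
  by_contra hcon
  refine hsep (isSeparated_of_annihilator (P := {(a, d₀)}) ?_ haT hbT hd₀ le_rfl hd₀b rfl hcd hac
    hdb (y := s - x) ?_ ?_ hcon)
  · rintro p rfl
    exact ⟨haT, hd₀.stable_right⟩
  · exact sub_mem (Algebra.subset_adjoin (Set.mem_insert s T)) (Algebra.adjoin_mono hsub hx)
  · rintro p rfl
    exact hxd

theorem hasSmallSubsets (N : ℕ) : HasSmallSubsets K V N := by
  classical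
  induction N using Nat.strong_induction_on with
  | _ N ih =>
  intro T S a b hN h
  have key2 : ∀ {T : Set (End K V)}, stableLength T a b ≤ N → IsSeparated T a b →
      IsSimpleFactor (T ∪ S) a b → ∃ R ⊆ S, R.card + 2 ≤ 2 * N ∧ IsSimpleFactor (T ∪ R) a b :=
    fun h1 h2 h3 => exists_small_subset_of_isSeparated ih h1 h2 S h3
  refine ⟨?_, fun hsep => key2 hN.le hsep h⟩
  have haT : StableUnder T a := h.stable_left.anti Set.subset_union_left
  have hbT : StableUnder T b := h.stable_right.anti Set.subset_union_left
  have hone := one_le_stableLength haT hbT h.lt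
  rcases hone.eq_or_lt with e1 | hN2
  · exact ⟨∅, Finset.empty_subset S, by rw [Finset.card_empty]; omega,
      by simpa using IsSimpleFactor.of_stableLength_le_one haT hbT h.lt e1.ge⟩
  have hinsT : ∀ s ∈ S, insert s T ⊆ T ∪ S := fun s hs =>
    Set.insert_subset (.inr hs) Set.subset_union_left
  have haI : ∀ s ∈ S, StableUnder (insert s T) a := fun s hs => h.stable_left.anti (hinsT s hs)
  have hbI : ∀ s ∈ S, StableUnder (insert s T) b := fun s hs => h.stable_right.anti (hinsT s hs)
  have hbig : ∀ s ∈ S, IsSimpleFactor (insert s T ∪ S) a b := fun s hs =>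
    h.of_stable (Set.union_subset_union_left _ (Set.subset_insert s T))
      ((haI s hs).union (h.stable_left.anti Set.subset_union_right))
      ((hbI s hs).union (h.stable_right.anti Set.subset_union_right))
  have hinsU : ∀ (s : End K V) (R : Finset (End K V)),
      T ∪ ((insert s R : Finset (End K V)) : Set (End K V)) = insert s T ∪ R := fun s R => by
    rw [Finset.coe_insert, Set.union_insert, Set.insert_union]
  -- One operator is spent to reach the separated bound: `1 + (2N - 2)`.
  by_cases hi : ∃ s ∈ S, IsSeparated (insert s T) a b
  · obtain ⟨s, hs, hsep⟩ := hi
    obtain ⟨R, hRS, hc, hR⟩ := key2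
      ((stableLength_anti (Set.subset_insert s T) (haI s hs) (hbI s hs) h.lt.le).trans hN.le) hsep
      (hbig s hs)
    refine ⟨insert s R, Finset.insert_subset hs hRS, ?_, by rwa [hinsU]⟩
    have := Finset.card_insert_le s R
    omega
  -- One operator is spent to lower the length: at most `1 + (2(N - 1) - 1)`.
  by_cases hii : ∃ s ∈ S, stableLength (insert s T) a b < N
  · obtain ⟨s, hs, hlt⟩ := hii
    obtain ⟨R, hRS, hc, hR⟩ := (ih _ hlt _ S a b rfl (hbig s hs)).1
    refine ⟨insert s R, Finset.insert_subset hs hRS, ?_, by rwa [hinsU]⟩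
    have := Finset.card_insert_le s R
    omega
  push Not at hi hii
  have hx : ∀ s ∈ S, ∃ x ∈ Algebra.adjoin K T, ∀ c d, a ≤ c → d ≤ b →
      IsSimpleFactor (insert s T) c d → d ≤ c.comap (s - x) := fun s hs =>
    exists_sub_annihilates (haI s hs) (hbI s hs) h.lt (hi s hs) (hN ▸ hii s hs)
  choose! x hxT hxs using hx
  -- A smallest subset that makes a new simple factor anywhere in the interval. Minimality forces
  -- every simple factor visible to a proper subset of `R` to be simple for `T` already.
  obtain ⟨R, ⟨hRS, c, d, hac, hdb, hcd, hncd⟩, hmin⟩ := WellFounded.has_min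
    (wellFounded_lt (α := Finset (End K V)))
    {R | R ⊆ S ∧ ∃ c d, a ≤ c ∧ d ≤ b ∧ IsSimpleFactor (T ∪ R) c d ∧ ¬ IsSimpleFactor T c d}
    ⟨S, subset_rfl, a, b, le_rfl, le_rfl, h, fun hsim => by
      have := hsim.stableLength_eq_one
      omega⟩
  have hcT : StableUnder T c := hcd.stable_left.anti Set.subset_union_left
  have hdT : StableUnder T d := hcd.stable_right.anti Set.subset_union_left
  have hD : ∀ s ∈ R, ∃ D ≤ d, IsSimpleFactor T c D ∧ StableUnder (R.erase s : Set (End K V)) D := by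
    intro s hs
    have hsub : T ∪ (R.erase s : Set (End K V)) ⊆ T ∪ R :=
      Set.union_subset_union_right T (Finset.coe_subset.2 (Finset.erase_subset s R))
    obtain ⟨D, hDd, hD⟩ := IsSimpleFactor.exists_left (hcd.stable_left.anti hsub)
      (hcd.stable_right.anti hsub) hcd.lt
    refine ⟨D, hDd, ?_, hD.stable_right.anti Set.subset_union_right⟩
    by_contra hnot
    exact hmin (R.erase s) ⟨(Finset.erase_subset s R).trans hRS, c, D, hac, hDd.trans hdb, hD, hnot⟩
      (Finset.erase_ssubset hs)
  choose! D hDd hDs hDR using hD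
  have hcs : ∀ s ∈ R, c ≤ c.comap s := fun s hs => hcd.stable_left s (.inr hs)
  -- The operators `t - x t` are dual to the `D s`: for `t ≠ s`, `D s` is still simple after adding
  -- `t`, so `t - x t` kills it modulo `c`. If `s - x s` did so for `D s`, then `D s` would be
  -- stable under all of `R` and equal `d`, making `c < d` simple for `T`.
  have hcard : R.card ≤ stableLength T c d := by
    refine card_le_stableLength_of_dual R D (fun s => s - x s) hcT hdT hcd.lt.le
      (fun s hs => (hDs s hs).stable_right) hDd ?_ ?_ ?_
    · intro s hs v hv
      exact c.sub_mem (hcs s hs hv) (hcT.of_mem_adjoin (hxT s (hRS hs)) hv)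
    · intro s hs t ht hts
      refine hxs t (hRS ht) c (D s) hac ((hDd s hs).trans hdb)
        ((hDs s hs).of_stable (Set.subset_insert t T) (hcT.insert (hcs t ht))
          ((hDs s hs).stable_right.insert ?_))
      exact hDR s hs t (Finset.mem_erase.2 ⟨hts, ht⟩)
    · intro s hs hle
      have hDst : StableUnder T (D s) := (hDs s hs).stable_right
      have hst : StableUnder (T ∪ R) (D s) := hDst.union fun t ht => by
        by_cases hts : t = s
        · subst hts
          intro v hv
          have := (D t).add_mem ((hDs t hs).lt.le (hle hv))
            (hDst.of_mem_adjoin (hxT t (hRS hs)) hv)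
          simpa using this
        · exact hDR s hs t (Finset.mem_erase.2 ⟨hts, ht⟩)
      have := hcd.eq_of_lt hst (hDs s hs).lt (hDd s hs)
      exact hncd (this ▸ hDs s hs)
  have hl2 : 2 ≤ stableLength T c d := by
    by_contra hcon
    exact hncd (.of_stableLength_le_one hcT hdT hcd.lt (by omega))
  have hTT : T ⊆ T ∪ (R : Set (End K V)) := Set.subset_union_left
  have hsub : T ∪ (R : Set (End K V)) ⊆ T ∪ S :=
    Set.union_subset_union_right T (Finset.coe_subset.2 hRS)
  have ha₁ := h.stable_left.anti hsub
  have hb₁ := h.stable_right.anti hsub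
  have hle := hcd.stableLength_add_le_of_subset hTT ha₁ hb₁ hac hdb
  have hlarge : IsSimpleFactor (T ∪ (R : Set (End K V)) ∪ S) a b :=
    h.of_stable (Set.union_subset_union_left _ hTT)
      (ha₁.union (h.stable_left.anti Set.subset_union_right))
      (hb₁.union (h.stable_right.anti Set.subset_union_right))
  -- With `l ≥ 2` the `T`-length from `c` to `d`, the remaining length is at most `N - l + 1 < N`,
  -- and the total `l + 2(N - l + 1) - 1` is at most `2N - 1`.
  obtain ⟨R₂, hR₂, hc₂, hs₂⟩ := (ih _ (by omega) _ S a b rfl hlarge).1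
  refine ⟨R ∪ R₂, Finset.union_subset hRS hR₂, ?_, ?_⟩
  · have := Finset.card_union_le R R₂
    omega
  · rwa [Finset.coe_union, ← Set.union_assoc]

end SmallSubsets

/-! ### Finiteness, extension of scalars and the upper bound -/

section BaseChange

variable {F : Type*} [Field F]

lemma Algebra.exists_finset_of_mem_adjoin {A : Type*} [Semiring A] [Algebra F A] {S : Set A} {x : A}
    (hx : x ∈ Algebra.adjoin F S) : ∃ t : Finset A, ↑t ⊆ S ∧ x ∈ Algebra.adjoin F (t : Set A) := by
  classical
  induction hx using Algebra.adjoin_induction with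
  | mem x hx => exact ⟨{x}, by simpa using hx, Algebra.subset_adjoin (by simp)⟩
  | algebraMap r => exact ⟨∅, by simp, Subalgebra.algebraMap_mem _ r⟩
  | add x y _ _ hx hy =>
    obtain ⟨t, ht, hxt⟩ := hx
    obtain ⟨u, hu, hyu⟩ := hy
    refine ⟨t ∪ u, by simp [ht, hu], add_mem (Algebra.adjoin_mono ?_ hxt)
      (Algebra.adjoin_mono ?_ hyu)⟩ <;> simp
  | mul x y _ _ hx hy =>
    obtain ⟨t, ht, hxt⟩ := hx
    obtain ⟨u, hu, hyu⟩ := hy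
    refine ⟨t ∪ u, by simp [ht, hu], mul_mem (Algebra.adjoin_mono ?_ hxt)
      (Algebra.adjoin_mono ?_ hyu)⟩ <;> simp

lemma IsIrredundantGeneratingSet.eq_of_subset {A : Type*} [Semiring A] [Algebra F A] {S T : Set A}
    (h : IsIrredundantGeneratingSet F S) (hT : T ⊆ S) (hgen : Algebra.adjoin F T = ⊤) : T = S := by
  by_contra hne
  exact h.2 T (hT.ssubset_of_ne hne) hgen

/-- In a finite-dimensional algebra, irredundant generating sets are finite. -/
lemma IsIrredundantGeneratingSet.finite {A : Type*} [Ring A] [Algebra F A] [FiniteDimensional F A]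
    {S : Set A} (h : IsIrredundantGeneratingSet F S) : S.Finite := by
  classical
  have hmem : ∀ i, ∃ t : Finset A, ↑t ⊆ S ∧ finBasis F A i ∈ Algebra.adjoin F (t : Set A) :=
    fun i => Algebra.exists_finset_of_mem_adjoin (h.1 ▸ Algebra.mem_top)
  choose t ht htm using hmem
  let u : Finset A := Finset.univ.biUnion t
  suffices (u : Set A) = S from this ▸ u.finite_toSet
  refine h.eq_of_subset (by simpa [u] using ht) ?_
  rw [← Algebra.toSubmodule_eq_top, eq_top_iff, ← (finBasis F A).span_eq, span_le]
  rintro _ ⟨i, rfl⟩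
  refine Algebra.adjoin_mono ?_ (htm i)
  exact Finset.coe_subset.2 (Finset.subset_biUnion_of_mem t (Finset.mem_univ i))

variable (K : Type*) [Field K] [Algebra F K] {n : ℕ}

/-- A matrix over `F` as an operator over an extension field. -/
noncomputable def Matrix.toEndExtension (n : ℕ) :
    Matrix (Fin n) (Fin n) F →+* End K (Fin n → K) :=
  (Matrix.toLinAlgEquiv' : Matrix (Fin n) (Fin n) K ≃ₐ[K] _).toRingEquiv.toRingHom.comp
    (algebraMap F K).mapMatrix

open Matrix in
lemma Matrix.toEndExtension_apply (A : Matrix (Fin n) (Fin n) F) (v : Fin n → K) :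
    Matrix.toEndExtension K n A v = A.map (algebraMap F K) *ᵥ v := rfl

lemma Matrix.toEndExtension_injective :
    Function.Injective (Matrix.toEndExtension (F := F) K n) :=
  (Matrix.toLinAlgEquiv' : Matrix (Fin n) (Fin n) K ≃ₐ[K] _).injective.comp (Matrix.map_injective (algebraMap F K).injective)

open Matrix in
/-- Matrices over `F` that generate the matrix algebra over an extension field already generate it
over `F`. -/
lemma adjoin_eq_top_of_toEndExtension (T : Set (Matrix (Fin n) (Fin n) F))
    (h : Algebra.adjoin K (toEndExtension K n '' T) = ⊤) : Algebra.adjoin F T = ⊤ := by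
  rw [← Algebra.toSubmodule_eq_top]
  by_contra hne
  obtain ⟨f, hf0, hf⟩ := Submodule.exists_le_ker_of_lt_top _ (lt_top_iff_ne_top.2 hne)
  -- The scalar extension of `f`, a functional vanishing on the `F`-algebra of `T`. It vanishes on
  -- all products of members of `T`, and these span the `K`-algebra.
  let fK : End K (Fin n → K) →ₗ[K] K :=
    ∑ i, ∑ j, (algebraMap F K (f (Matrix.single i j 1))) •
      ((LinearMap.proj i).comp (LinearMap.applyₗ (Pi.single j (1 : K) : Fin n → K)))
  have hfK : ∀ A : Matrix (Fin n) (Fin n) F, fK (toEndExtension K n A) = algebraMap F K (f A) := by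
    intro A
    have h1 : ∀ i j, toEndExtension K n A (Pi.single j 1) i = algebraMap F K (A i j) := by
      intro i j
      simp [toEndExtension_apply]
    conv_rhs => rw [matrix_eq_sum_single A]
    simp only [fK, LinearMap.sum_apply, LinearMap.smul_apply, LinearMap.comp_apply,
      LinearMap.applyₗ_apply_apply, LinearMap.proj_apply, h1, map_sum]
    refine Finset.sum_congr rfl fun i _ => Finset.sum_congr rfl fun j _ => ?_
    have : Matrix.single i j (A i j) = A i j • Matrix.single i j (1 : F) := by simp
    rw [this, map_smul, smul_eq_mul, smul_eq_mul, map_mul, mul_comm]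
  have hzero : ∀ g, fK g = 0 := by
    intro g
    have hg : g ∈ Subalgebra.toSubmodule (Algebra.adjoin K (toEndExtension K n '' T)) := by
      rw [h]; trivial
    rw [Algebra.adjoin_eq_span] at hg
    suffices span K _ ≤ LinearMap.ker fK from this hg
    rw [span_le]
    intro y hy
    have himg : (toEndExtension K n '' T) = (toEndExtension K n).toMonoidHom '' T := rfl
    rw [himg, ← MonoidHom.map_mclosure] at hy
    obtain ⟨A, hA, rfl⟩ := hy
    have hAT : A ∈ Algebra.adjoin F T :=
      (Submonoid.closure_le.2 Algebra.subset_adjoin : _ ≤ (Algebra.adjoin F T).toSubmonoid) hA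
    have : f A = 0 := hf hAT
    change fK (toEndExtension K n A) = 0
    rw [hfK, this, map_zero]
  refine hf0 (LinearMap.ext fun A => (algebraMap F K).injective ?_)
  rw [← hfK, hzero, LinearMap.zero_apply, map_zero]

open Matrix in
/-- A generating set of matrices over `F` is irreducible over every extension field. -/
lemma isSimpleFactor_of_adjoin_eq_top [NeZero n] (S : Set (Matrix (Fin n) (Fin n) F))
    (h : Algebra.adjoin F S = ⊤) :
    IsSimpleFactor (toEndExtension K n '' S) (⊥ : Submodule K (Fin n → K)) ⊤ where
  lt := bot_lt_top
  stable_left f _ v hv := by simp_all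
  stable_right f _ v hv := trivial
  eq_or_eq W hW _ _ := by
    have key : ∀ A : Matrix (Fin n) (Fin n) F, W ≤ W.comap (toEndExtension K n A) := by
      intro A
      have hA : A ∈ Algebra.adjoin F S := h ▸ Algebra.mem_top
      induction hA using Algebra.adjoin_induction with
      | mem x hx => exact hW _ ⟨x, hx, rfl⟩
      | algebraMap r =>
        intro v hv
        have : toEndExtension K n (algebraMap F (Matrix (Fin n) (Fin n) F) r) v = algebraMap F K r • v := by
          rw [toEndExtension_apply, Matrix.algebraMap_eq_diagonal, Matrix.diagonal_map (map_zero _)]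
          ext i
          simp [Matrix.mulVec_diagonal]
        rw [mem_comap, this]
        exact W.smul_mem _ hv
      | add x y _ _ hx hy =>
        intro v hv
        rw [mem_comap, map_add]
        exact W.add_mem (hx hv) (hy hv)
      | mul x y _ _ hx hy =>
        intro v hv
        rw [mem_comap, map_mul]
        exact hx (hy hv)
    by_cases hbot : W = ⊥
    · exact .inl hbot
    right
    obtain ⟨v, hv, hv0⟩ := W.ne_bot_iff.1 hbot
    obtain ⟨j, hj⟩ := Function.ne_iff.1 hv0
    have hsingle : ∀ i, (Pi.single i (1 : K) : Fin n → K) ∈ W := by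
      intro i
      have h1 := W.smul_mem (v j)⁻¹ (key (Matrix.single i j 1) hv)
      convert h1 using 1
      have hj' : v j ≠ 0 := hj
      rw [toEndExtension_apply, Matrix.map_single, map_one, Matrix.single_mulVec_eq, one_mul,
        smul_smul, inv_mul_cancel₀ hj', one_smul]
    rw [eq_top_iff, ← (Pi.basisFun K (Fin n)).span_eq, span_le]
    rintro _ ⟨i, rfl⟩
    simpa using hsingle i

open Matrix in
/-- Irredundant generating sets of the algebra of `n × n` matrices have at most `2n - 1` elements. -/
theorem IsIrredundantGeneratingSet.ncard_le [NeZero n] {S : Set (Matrix (Fin n) (Fin n) F)}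
    (h : IsIrredundantGeneratingSet F S) : S.ncard ≤ 2 * n - 1 := by
  classical
  let K := AlgebraicClosure F
  obtain ⟨S, rfl⟩ := h.finite.exists_finset_coe
  have hirr := isSimpleFactor_of_adjoin_eq_top K _ h.1
  have hirr' : IsSimpleFactor (∅ ∪ ((S.image (toEndExtension K n) : Finset (End K (Fin n → K))) :
      Set (End K (Fin n → K)))) ⊥ ⊤ := by
    rwa [Set.empty_union, Finset.coe_image]
  obtain ⟨R, hRS, hR, hRirr⟩ := (hasSmallSubsets _ _ _ _ _ rfl hirr').1
  rw [Set.empty_union] at hRirr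
  have hlen : stableLength ∅ (⊥ : Submodule K (Fin n → K)) ⊤ ≤ n := by
    refine (stableLength_le_finrank (by simp [StableUnder]) (by simp [StableUnder]) bot_le).trans ?_
    simp
  have htop : Algebra.adjoin K (R : Set (End K (Fin n → K))) = ⊤ :=
    Subalgebra.eq_top_of_irreducible _ fun W hW => hRirr.eq_or_eq W
      (fun f hf => hW f (Algebra.subset_adjoin hf)) bot_le le_top
  -- The members of `S` lying over `R` already generate over `F`, so by irredundancy they are all of
  -- `S`.
  have hsub : ((S.filter fun s => toEndExtension K n s ∈ R : Finset _) :
      Set (Matrix (Fin n) (Fin n) F)) = S := by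
    refine h.eq_of_subset (Finset.coe_subset.2 (Finset.filter_subset _ S)) ?_
    refine adjoin_eq_top_of_toEndExtension K _ (htop ▸ congrArg _ ?_)
    ext f
    constructor
    · rintro ⟨s, hs, rfl⟩
      exact (Finset.mem_filter.1 hs).2
    · intro hf
      obtain ⟨s, hs, rfl⟩ := Finset.mem_image.1 (hRS hf)
      exact ⟨s, Finset.mem_filter.2 ⟨hs, hf⟩, rfl⟩
  have hcard : S.card ≤ R.card := by
    rw [← Finset.card_image_of_injective S (toEndExtension_injective (F := F) K (n := n))]
    refine Finset.card_le_card fun f hf => ?_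
    obtain ⟨s, hs, rfl⟩ := Finset.mem_image.1 hf
    have : s ∈ ((S.filter fun s => toEndExtension K n s ∈ R : Finset _) :
      Set (Matrix (Fin n) (Fin n) F)) := by rw [hsub]; exact hs
    exact (Finset.mem_filter.1 this).2
  rw [Set.ncard_coe_finset]
  omega

end BaseChange

/-! ### The explicit irredundant generating set -/

section Family

variable {F : Type*} [Field F]

/-- A generating family whose members can each be avoided by a proper subalgebra containing the
others is injective and irredundant. -/
lemma injective_and_isIrredundantGeneratingSet_range {A ι : Type*} [Semiring A] [Algebra F A]
    (g : ι → A) (hgen : Algebra.adjoin F (Set.range g) = ⊤)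
    (B : ι → Subalgebra F A) (hB : ∀ i, B i ≠ ⊤) (hg : ∀ i j, j ≠ i → g j ∈ B i) :
    Function.Injective g ∧ IsIrredundantGeneratingSet F (Set.range g) := by
  have hnot : ∀ i, g i ∉ B i := fun i hi => hB i <| by
    rw [eq_top_iff, ← hgen]
    refine Algebra.adjoin_le ?_
    rintro _ ⟨j, rfl⟩
    by_cases e : j = i
    · exact e ▸ hi
    · exact hg i j e
  refine ⟨fun i j hij => ?_, hgen, fun T hT htop => ?_⟩
  · by_contra hne
    exact hnot i (hij ▸ hg i j (Ne.symm hne))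
  · obtain ⟨_, ⟨i, rfl⟩, hi⟩ := Set.exists_of_ssubset hT
    refine hB i (eq_top_iff.2 (htop ▸ Algebra.adjoin_le fun x hx => ?_))
    obtain ⟨j, rfl⟩ := hT.1 hx
    exact hg i j fun e => hi (e ▸ hx)

open Matrix

variable {n : ℕ}

/-- The matrices preserving a given subspace of column vectors. -/
def Matrix.stabilizer (W : Submodule F (Fin n → F)) : Subalgebra F (Matrix (Fin n) (Fin n) F) where
  carrier := {M | ∀ v ∈ W, M *ᵥ v ∈ W}
  mul_mem' hA hB v hv := by
    rw [← Matrix.mulVec_mulVec]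
    exact hA _ (hB v hv)
  add_mem' hA hB v hv := by
    rw [Matrix.add_mulVec]
    exact W.add_mem (hA v hv) (hB v hv)
  algebraMap_mem' r v hv := by
    rw [Algebra.algebraMap_eq_smul_one, Matrix.smul_mulVec, Matrix.one_mulVec]
    exact W.smul_mem r hv

lemma Matrix.stabilizer_ne_top {W : Submodule F (Fin n → F)} {v : Fin n → F} (hv : v ∈ W)
    {j : Fin n} (hj : v j = 1) {i : Fin n} (hi : Pi.single i 1 ∉ W) :
    Matrix.stabilizer W ≠ ⊤ := fun htop => hi <| by
  have : Matrix.single i j 1 ∈ Matrix.stabilizer W := htop ▸ Algebra.mem_top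
  have h := this v hv
  rw [Matrix.single_mulVec_eq, hj] at h
  simpa using h

lemma upperRowMatrix_eq {i : ℕ} (hi : i + 1 < n) : upperRowMatrix F n i =
    Matrix.single ⟨i, by omega⟩ ⟨i, by omega⟩ 1 + Matrix.single ⟨i, by omega⟩ ⟨i + 1, hi⟩ 1 := by
  ext p q
  simp only [upperRowMatrix, Matrix.of_apply, Matrix.add_apply, Matrix.single_apply, Fin.ext_iff]
  split_ifs <;> first | omega | simp

lemma lowerRowMatrix_eq {i : ℕ} (hi : i + 1 < n) : lowerRowMatrix F n i =
    Matrix.single ⟨i + 1, hi⟩ ⟨i, by omega⟩ 1 + Matrix.single ⟨i + 1, hi⟩ ⟨i + 1, hi⟩ 1 := by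
  ext p q
  simp only [lowerRowMatrix, Matrix.of_apply, Matrix.add_apply, Matrix.single_apply, Fin.ext_iff]
  split_ifs <;> first | omega | simp

lemma cornerMatrix_eq (hn : 0 < n) : cornerMatrix F n = Matrix.single ⟨0, hn⟩ ⟨0, hn⟩ 1 := by
  ext p q
  simp only [cornerMatrix, Matrix.of_apply, Matrix.single_apply, Fin.ext_iff]
  split_ifs <;> first | omega | simp

lemma upperRowMatrix_mulVec {i : ℕ} (hi : i + 1 < n) (v : Fin n → F) (p : Fin n) :
    (upperRowMatrix F n i *ᵥ v) p =
      if p.val = i then v ⟨i, by omega⟩ + v ⟨i + 1, hi⟩ else 0 := by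
  rw [upperRowMatrix_eq hi, Matrix.add_mulVec, Matrix.single_mulVec_eq, Matrix.single_mulVec_eq]
  simp only [Pi.add_apply, Pi.smul_apply, Pi.single_apply, Fin.ext_iff]
  split_ifs <;> simp

lemma lowerRowMatrix_mulVec {i : ℕ} (hi : i + 1 < n) (v : Fin n → F) (p : Fin n) :
    (lowerRowMatrix F n i *ᵥ v) p =
      if p.val = i + 1 then v ⟨i, by omega⟩ + v ⟨i + 1, hi⟩ else 0 := by
  rw [lowerRowMatrix_eq hi, Matrix.add_mulVec, Matrix.single_mulVec_eq, Matrix.single_mulVec_eq]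
  simp only [Pi.add_apply, Pi.smul_apply, Pi.single_apply, Fin.ext_iff]
  split_ifs <;> simp

lemma cornerMatrix_mulVec (hn : 0 < n) (v : Fin n → F) (p : Fin n) :
    (cornerMatrix F n *ᵥ v) p = if p.val = 0 then v ⟨0, hn⟩ else 0 := by
  rw [cornerMatrix_eq hn, Matrix.single_mulVec_eq]
  simp only [Pi.smul_apply, Pi.single_apply, Fin.ext_iff]
  split_ifs <;> simp

/-- Vectors supported in the coordinates satisfying `P`. -/
def supportedIn (F : Type*) [Field F] (n : ℕ) (P : ℕ → Prop) : Submodule F (Fin n → F) where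
  carrier := {v | ∀ q : Fin n, ¬ P q.val → v q = 0}
  add_mem' hv hw q hq := by simp [hv q hq, hw q hq]
  zero_mem' _ _ := rfl
  smul_mem' c v hv q hq := by simp [hv q hq]

/-- Vectors in which adjacent coordinates are opposite. -/
def alternating (F : Type*) [Field F] (n : ℕ) : Submodule F (Fin n → F) where
  carrier := {v | ∀ p q : Fin n, q.val = p.val + 1 → v p + v q = 0}
  add_mem' hv hw p q h := by
    rw [Pi.add_apply, Pi.add_apply, add_add_add_comm, hv p q h, hw p q h, add_zero]
  zero_mem' _ _ _ := add_zero _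
  smul_mem' c v hv p q h := by
    rw [Pi.smul_apply, Pi.smul_apply, ← smul_add, hv p q h, smul_zero]

lemma supportedIn_stabilizer_ne_top {P : ℕ → Prop} {i j : Fin n} (hi : ¬ P i.val) (hj : P j.val) :
    Matrix.stabilizer (supportedIn F n P) ≠ ⊤ :=
  Matrix.stabilizer_ne_top (v := Pi.single j 1) (j := j) (i := i)
    (fun q hq => Pi.single_eq_of_ne (fun e : q = j => hq (by rwa [e])) _) (Pi.single_eq_same j 1)
    fun h => by simpa using h i hi

lemma alternating_stabilizer_ne_top (hn : 1 < n) :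
    Matrix.stabilizer (alternating F n) ≠ ⊤ := by
  refine Matrix.stabilizer_ne_top (v := fun q => (-1) ^ q.val) (j := ⟨0, by omega⟩)
    (i := ⟨0, by omega⟩) (fun p q h => ?_) (by simp) fun h => ?_
  · simp only [h, pow_succ]
    ring
  · have := h ⟨0, by omega⟩ ⟨1, hn⟩ rfl
    simp at this

/-- An indexing of the explicit generating set. -/
def explicitFamily (F : Type*) [Field F] (n : ℕ) :
    Option (Fin (n - 1) ⊕ Fin (n - 1)) → Matrix (Fin n) (Fin n) F
  | none => cornerMatrix F n
  | some (.inl i) => upperRowMatrix F n i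
  | some (.inr i) => lowerRowMatrix F n i

lemma range_explicitFamily : Set.range (explicitFamily F n) = explicitIrredundantSet F n := by
  ext M
  simp only [explicitIrredundantSet, Set.mem_range, Set.mem_union, Set.mem_singleton_iff]
  constructor
  · rintro ⟨_ | _ | i, rfl⟩
    · exact .inr rfl
    · exact .inl (.inl ⟨_, rfl⟩)
    · exact .inl (.inr ⟨_, rfl⟩)
  · rintro ((⟨i, rfl⟩ | ⟨i, rfl⟩) | rfl)
    · exact ⟨some (.inl i), rfl⟩
    · exact ⟨some (.inr i), rfl⟩
    · exact ⟨none, rfl⟩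

/-- A subalgebra containing all matrix units of the first row and column is everything. -/
lemma Matrix.subalgebra_eq_top_of_single_mem (hn : 0 < n)
    (B : Subalgebra F (Matrix (Fin n) (Fin n) F))
    (hB : ∀ k, Matrix.single ⟨0, hn⟩ k 1 ∈ B ∧ Matrix.single k ⟨0, hn⟩ 1 ∈ B) : B = ⊤ := by
  rw [eq_top_iff]
  intro M _
  rw [Matrix.matrix_eq_sum_single M]
  refine sum_mem fun i _ => sum_mem fun j _ => ?_
  have : Matrix.single i j (M i j) =
      M i j • (Matrix.single i ⟨0, hn⟩ (1 : F) * Matrix.single ⟨0, hn⟩ j 1) := by simp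
  rw [this]
  exact B.smul_mem (mul_mem (hB i).2 (hB j).1) _

/-- Starting from the corner unit, the `k`-th diagonal unit subtracted from the upper matrix gives
`e_{k,k+1}`, and multiplied by the lower matrix gives `e_{k+1,k}`; their product is the next
diagonal unit. -/
lemma adjoin_explicitIrredundantSet (hn : 0 < n) :
    Algebra.adjoin F (explicitIrredundantSet F n) = ⊤ := by
  set B := Algebra.adjoin F (explicitIrredundantSet F n)
  have hu : ∀ k, k + 1 < n → upperRowMatrix F n k ∈ B := fun k hk =>
    Algebra.subset_adjoin (.inl (.inl ⟨⟨k, by omega⟩, rfl⟩))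
  have hl : ∀ k, k + 1 < n → lowerRowMatrix F n k ∈ B := fun k hk =>
    Algebra.subset_adjoin (.inl (.inr ⟨⟨k, by omega⟩, rfl⟩))
  have hc : cornerMatrix F n ∈ B := Algebra.subset_adjoin (.inr rfl)
  rw [cornerMatrix_eq hn] at hc
  have key : ∀ k (hk : k < n), Matrix.single ⟨k, hk⟩ ⟨k, hk⟩ 1 ∈ B ∧
      Matrix.single ⟨0, hn⟩ ⟨k, hk⟩ 1 ∈ B ∧ Matrix.single ⟨k, hk⟩ ⟨0, hn⟩ 1 ∈ B := by
    intro k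
    induction k with
    | zero => exact fun _ => ⟨hc, hc, hc⟩
    | succ k ih =>
      intro hk
      obtain ⟨h1, h2, h3⟩ := ih (by omega)
      have hup : Matrix.single ⟨k, by omega⟩ ⟨k + 1, hk⟩ 1 ∈ B := by
        have := sub_mem (hu k hk) h1
        rwa [upperRowMatrix_eq hk, add_sub_cancel_left] at this
      have hlow : Matrix.single ⟨k + 1, hk⟩ ⟨k, by omega⟩ 1 ∈ B := by
        have := mul_mem (hl k hk) h1
        rw [lowerRowMatrix_eq hk, add_mul, Matrix.single_mul_single_same,
          Matrix.single_mul_single_of_ne _ _ _ _ (by simp [Fin.ext_iff]), add_zero, mul_one] at this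
        exact this
      refine ⟨?_, ?_, ?_⟩
      · have := mul_mem hlow hup
        rwa [Matrix.single_mul_single_same, mul_one] at this
      · have := mul_mem h2 hup
        rwa [Matrix.single_mul_single_same, mul_one] at this
      · have := mul_mem hlow h3
        rwa [Matrix.single_mul_single_same, mul_one] at this
  exact Matrix.subalgebra_eq_top_of_single_mem hn B fun k => (key k k.2).2

/-- A proper subalgebra containing all members of the explicit family but one. -/
def avoidingSubalgebra (F : Type*) [Field F] (n : ℕ) :
    Option (Fin (n - 1) ⊕ Fin (n - 1)) → Subalgebra F (Matrix (Fin n) (Fin n) F)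
  | none => Matrix.stabilizer (alternating F n)
  | some (.inl i) => Matrix.stabilizer (supportedIn F n fun q => i.val < q)
  | some (.inr i) => Matrix.stabilizer (supportedIn F n fun q => q ≤ i.val)

lemma avoidingSubalgebra_ne_top (hn : 1 < n) (x : Option (Fin (n - 1) ⊕ Fin (n - 1))) :
    avoidingSubalgebra F n x ≠ ⊤ := by
  rcases x with _ | i | i
  · exact alternating_stabilizer_ne_top hn
  · exact supportedIn_stabilizer_ne_top (i := ⟨0, by omega⟩) (j := ⟨i + 1, by omega⟩)
      (by simp) (by simp)
  · exact supportedIn_stabilizer_ne_top (i := ⟨i + 1, by omega⟩) (j := ⟨0, by omega⟩)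
      (by simp) (by simp)

/-- Both row matrices read the sum of coordinates `j` and `j + 1`, so they kill alternating vectors.
The upper one writes to `j` and the lower one to `j + 1`, so only the upper matrix at `i` moves
support from above `i` down to `i`, and only the lower one moves it from `i` up to `i + 1`. -/
lemma explicitFamily_mem_avoidingSubalgebra (hn : 1 < n)
    (x y : Option (Fin (n - 1) ⊕ Fin (n - 1))) (hxy : y ≠ x) :
    explicitFamily F n y ∈ avoidingSubalgebra F n x := by
  rcases x with _ | i | i <;> rcases y with _ | j | j
  · exact absurd rfl hxy
  · intro v hv
    have h0 : upperRowMatrix F n j *ᵥ v = 0 := by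
      ext p
      rw [upperRowMatrix_mulVec (by omega : j.val + 1 < n), hv _ _ rfl, ite_self, Pi.zero_apply]
    exact h0.symm ▸ Submodule.zero_mem (alternating F n)
  · intro v hv
    have h0 : lowerRowMatrix F n j *ᵥ v = 0 := by
      ext p
      rw [lowerRowMatrix_mulVec (by omega : j.val + 1 < n), hv _ _ rfl, ite_self, Pi.zero_apply]
    exact h0.symm ▸ Submodule.zero_mem (alternating F n)
  · intro v hv p hp
    dsimp only at hp
    change (cornerMatrix F n *ᵥ v) p = 0
    rw [cornerMatrix_mulVec (by omega : 0 < n), hv _ (by simp), ite_self]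
  · intro v hv p hp
    dsimp only at hp
    have hne : j.val ≠ i.val := fun e => hxy (by rw [Fin.ext e])
    change (upperRowMatrix F n j *ᵥ v) p = 0
    rw [upperRowMatrix_mulVec (by omega : j.val + 1 < n)]
    split_ifs with h
    · rw [hv _ (by dsimp only; omega), hv _ (by dsimp only; omega), add_zero]
    · rfl
  · intro v hv p hp
    dsimp only at hp
    change (lowerRowMatrix F n j *ᵥ v) p = 0
    rw [lowerRowMatrix_mulVec (by omega : j.val + 1 < n)]
    split_ifs with h
    · rw [hv _ (by dsimp only; omega), hv _ (by dsimp only; omega), add_zero]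
    · rfl
  · intro v hv p hp
    dsimp only at hp
    change (cornerMatrix F n *ᵥ v) p = 0
    rw [cornerMatrix_mulVec (by omega : 0 < n), if_neg (by omega)]
  · intro v hv p hp
    dsimp only at hp
    change (upperRowMatrix F n j *ᵥ v) p = 0
    rw [upperRowMatrix_mulVec (by omega : j.val + 1 < n)]
    split_ifs with h
    · rw [hv _ (by dsimp only; omega), hv _ (by dsimp only; omega), add_zero]
    · rfl
  · intro v hv p hp
    dsimp only at hp
    have hne : j.val ≠ i.val := fun e => hxy (by rw [Fin.ext e])
    change (lowerRowMatrix F n j *ᵥ v) p = 0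
    rw [lowerRowMatrix_mulVec (by omega : j.val + 1 < n)]
    split_ifs with h
    · rw [hv _ (by dsimp only; omega), hv _ (by dsimp only; omega), add_zero]
    · rfl

lemma isIrredundantGeneratingSet_explicitIrredundantSet (hn : 1 < n) :
    IsIrredundantGeneratingSet F (explicitIrredundantSet F n) ∧
      (explicitIrredundantSet F n).encard = ((2 * n - 1 : ℕ) : ℕ∞) := by
  obtain ⟨hinj, hirr⟩ := injective_and_isIrredundantGeneratingSet_range (explicitFamily F n)
    (by rw [range_explicitFamily, adjoin_explicitIrredundantSet (by omega)])
    (avoidingSubalgebra F n) (avoidingSubalgebra_ne_top hn)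
    (explicitFamily_mem_avoidingSubalgebra hn)
  rw [range_explicitFamily] at hirr
  refine ⟨hirr, ?_⟩
  rw [← range_explicitFamily, ← Set.image_univ, hinj.encard_image, Set.encard_univ,
    ENat.card_eq_coe_fintype_card]
  congr 1
  simp only [Fintype.card_option, Fintype.card_sum, Fintype.card_fin]
  omega

end Family

theorem theorem1p1 (F : Type*) [Field F] (n : ℕ) (hn : 1 ≤ n) :
    (∀ S : Set (Matrix (Fin n) (Fin n) F), IsIrredundantGeneratingSet F S →
      S.Finite ∧ S.ncard ≤ 2 * n - 1) ∧
    (1 < n →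
      IsIrredundantGeneratingSet F (explicitIrredundantSet F n) ∧
      (explicitIrredundantSet F n).encard = ((2 * n - 1 : ℕ) : ℕ∞) ∧
      IsGreatest
        {k : ℕ∞ | ∃ S : Set (Matrix (Fin n) (Fin n) F),
          IsIrredundantGeneratingSet F S ∧ S.encard = k}
        ((2 * n - 1 : ℕ) : ℕ∞)) := by
  have : NeZero n := ⟨by omega⟩
  refine ⟨fun S hS => ⟨hS.finite, hS.ncard_le⟩, fun hn1 => ?_⟩
  obtain ⟨hirr, hcard⟩ := isIrredundantGeneratingSet_explicitIrredundantSet (F := F) hn1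
  refine ⟨hirr, hcard, ⟨_, hirr, hcard⟩, ?_⟩
  rintro _ ⟨S, hS, rfl⟩
  rw [← hS.finite.cast_ncard_eq]
  exact_mod_cast hS.ncard_le
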